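/- Let $R$ be a simplicial commutative $\mathbb F_2$-algebra. Let $C_*(R)$ be its associated chain complex, with $\partial=\sum_r d_r$, and let $\pi_qR=H_q(C_*(R))$. Let $Z_qR\subseteq R_q$ be the set of normalized cycles, i.e. of $z\in R_q$ with $d_rz=0$ for $0\le r\le q$. For $1\le i\le q$ let $V(q,i)$ be the set of pairs $(\mu,\nu)$ of sequences $\mu_1<\dots<\mu_i$ and $\nu_1<\dots<\nu_i$ such that $\{q-i,q-i+1,\dots,q+i-1\}$ is the disjoint union of $\{\mu_1,\dots,\mu_i\}$ and $\{\nu_1,\dots,\nu_i\}$, and $\mu_1=q-i$. For $z\in Z_qR$ put $$\delta_i(z)=\sum_{(\mu,\nu)\in V(q,i)} s_{\nu_i}\cdots s_{\nu_1}(z)\; s_{\mu_i}\cdots s_{\mu_1}(z)\in R_{q+i}.$$ A *choice of higher Eilenberg–MacLane maps* is a sequence of transformations $D^k_{i,j}:V_i\otimes W_j\to V_{i+j-k}\otimes W_{i+j-k}$ ($0\le 2k\le i+j$), natural in pairs $(V,W)$ of simplicial $\mathbb F_2$-vector spaces, such that $$D^0+TD^0T=D+\phi_0,\qquad D^k+TD^kT=D^{k-1}\partial+\partial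 D^{k-1}+\phi_k\quad(k\ge 1,\ 2k\le i+j).$$ Here $T$ exchanges the tensor factors, $D_{i,j}=\sum s_{\nu_j}\cdots s_{\nu_1}\otimes s_{\mu_i}\cdots s_{\mu_1}$ is the Eilenberg–MacLane map (a sum over $(i,j)$-shuffles), $\partial$ is the differential of $C(V)\otimes C(W)$ respectively of $C(V\otimes W)$, and $\phi_k$ is the identity on $V_k\otimes W_k$ and zero on $V_i\otimes W_j$ for $(i,j)\ne(k,k)$. Given such a choice and $x\in R_q$, put $\Theta_i(x)=\mu D^{q-i}(x\otimes x)+\mu D^{q-i-1}(x\otimes\partial x)$, where $\mu$ is the multiplication of $R$ and the second term is absent if $i=q$. For $2\le i\le q$, the Bousfield–Dwyer operation $\pi_qR\to\pi_{q+i}R$ is the map that sends, for every such choice, the class of every cycle $x\in C_q(R)$ to the class of $\Theta_i(x)$. For a natural transformation $\theta:V_i\otimes W_j\to V_k\otimes W_l$ let $\mathcal S\theta:V_{i+1}\otimes W_{j+1}\to V_{k+1}\otimes W_{l+1}$ be its suspension, i.e. $\theta$ evaluated on the shifted objects $(\mathcal SV)_n=V_{n+1}$, $(\mathcal SW)_n=W_{n+1}$,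 whose operators are $d_{r+1}$, $s_{r+1}$ in the place of $d_r$, $s_r$. A suspended transformation is understood to be zero on $V_0\otimes W_j$ and on $V_i\otimes W_0$, groups in negative degrees are zero, and $d_0$ is zero on $V_0$ and $W_0$. Define recursively $D^0=\mathcal S(D)(\mathrm{id}\otimes s_0)$ and, for $k\ge 1$, $$D^k=\mathcal S(D^{k-1})+\begin{cases}D^{k-1}(d_0\otimes\mathrm{id}) & k\text{ even},\\ D^{k-1}(\mathrm{id}\otimes d_0)& k\text{ odd}.\end{cases}$$ **Theorem.** Let $2\le i\le q$. 1. The recursively defined maps $D^k$ are a choice of higher Eilenberg–MacLane maps. 2. For these maps, $\delta_i(z)=\mu D^{q-i}(z\otimes z)=\Theta_i(z)$ for all $z\in Z_qR$. 3. The formula for $\delta_i$ defines a map $\delta_i:Z_qR\to Z_{q+i}R$. 4. There is exactly one map $\delta_i:\pi_qR\to\pi_{q+i}R$ with $\delta_i([z])=[\delta_i(z)]$ for all $z\in Z_qR$, and it is the Bousfield–Dwyer homotopy operation: for every choice of higher Eilenberg–MacLane maps and every cycle $x\in C_q(R)$, the element $\Theta_i(x)$ is a cycle and $\delta_i([x])=[\Theta_i(x)]$.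 -/

import Mathlib

open CategoryTheory Opposite
open scoped TensorProduct

universe u

noncomputable section

/-! ### Simplicial vector spaces over the field with two elements -/

/-- Simplicial `F_2`-vector spaces. -/
abbrev SVect : Type (u + 1) := SimplicialObject (ModuleCat.{u} (ZMod 2))

/-- Simplicial commutative `F_2`-algebras. -/
abbrev SAlg : Type (u + 1) := SimplicialObject (CommAlgCat.{u} (ZMod 2))

/-- The vector space underlying a commutative `F_2`-algebra, as a functor. -/
@[reducible]
def algToVect : CommAlgCat.{u} (ZMod 2) ⥤ ModuleCat.{u} (ZMod 2) where
  obj A := ModuleCat.of (ZMod 2) A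
  map f := ModuleCat.ofHom f.hom.toLinearMap

/-- The simplicial vector space underlying a simplicial algebra; it has the same elements. -/
abbrev SAlg.toVect (R : SAlg.{u}) : SVect.{u} := R ⋙ algToVect

/-- The vector space `V_n` of elements of degree `n`. -/
abbrev SVect.deg (V : SVect.{u}) (n : ℕ) : Type u := V.obj (op (SimplexCategory.mk n))

/-- The algebra `R_n` of elements of degree `n`. -/
abbrev SAlg.deg (R : SAlg.{u}) (n : ℕ) : Type u := R.obj (op (SimplexCategory.mk n))

/-- The linear map `V_i → V_k` induced by a morphism `[k] → [i]` of the simplicial category. -/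
def SVect.act (V : SVect.{u}) {i k : ℕ} (a : SimplexCategory.mk k ⟶ SimplexCategory.mk i) :
    V.deg i →ₗ[ZMod 2] V.deg k :=
  (V.map a.op).hom

/-- The component `V_n → V'_n` of a map of simplicial vector spaces. -/
def SVect.mapDeg {V V' : SVect.{u}} (f : V ⟶ V') (n : ℕ) : V.deg n →ₗ[ZMod 2] V'.deg n :=
  (f.app (op (SimplexCategory.mk n))).hom

/-- The differential `∂ = ∑_{0 ≤ r ≤ n+1} d_r : V_{n+1} → V_n` of the associated chain complex. -/
def SVect.bdrySucc (V : SVect.{u}) (n : ℕ) : V.deg (n + 1) →ₗ[ZMod 2] V.deg n :=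
  ∑ r : Fin (n + 2), (V.δ r).hom

/-- The differential `∂ : V_n → V_{n-1}` for every `n`; it is zero for `n = 0`. -/
def SVect.bdry (V : SVect.{u}) : (n : ℕ) → V.deg n →ₗ[ZMod 2] V.deg (n - 1)
  | 0 => 0
  | n + 1 => V.bdrySucc n

/-- The cycles of degree `n` in the associated chain complex `C_*(V)`. -/
def SVect.cycles (V : SVect.{u}) (n : ℕ) : Submodule (ZMod 2) (V.deg n) :=
  LinearMap.ker (V.bdry n)

/-- The boundaries of degree `n` in the associated chain complex `C_*(V)`. -/
def SVect.boundaries (V : SVect.{u}) (n : ℕ) : Submodule (ZMod 2) (V.deg n) :=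
  LinearMap.range (V.bdrySucc n)

/-- The homotopy group `π_n V = H_n(C_*(V))`. -/
abbrev SVect.homotopy (V : SVect.{u}) (n : ℕ) : Type u :=
  V.cycles n ⧸ (V.boundaries n).comap (V.cycles n).subtype

/-- The homotopy class of a cycle. -/
def SVect.cls (V : SVect.{u}) (n : ℕ) (x : V.deg n) (hx : x ∈ V.cycles n) : V.homotopy n :=
  Submodule.Quotient.mk ⟨x, hx⟩

/-- The normalized cycles `Z_n V`: the elements of `V_n` on which all the faces
`d_0, …, d_n` vanish (for `n = 0` there are no faces). -/
def SVect.normCycles (V : SVect.{u}) : (n : ℕ) → Submodule (ZMod 2) (V.deg n)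
  | 0 => ⊤
  | n + 1 => ⨅ r : Fin (n + 2), LinearMap.ker (V.δ r).hom

theorem SVect.normCycles_le_cycles (V : SVect.{u}) (n : ℕ) : V.normCycles n ≤ V.cycles n := by
  cases n with
  | zero =>
    intro x _
    simp [SVect.cycles, SVect.bdry]
  | succ n =>
    intro x hx
    simp only [SVect.normCycles, Submodule.mem_iInf, LinearMap.mem_ker] at hx
    have h : V.bdrySucc n x = 0 := by
      rw [SVect.bdrySucc, LinearMap.sum_apply]
      exact Finset.sum_eq_zero fun r _ => hx r
    exact h

/-- The identity `[m] = [n]` of the simplicial category, for equal numbers `m` and `n`. -/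
def castOp {m n : ℕ} (h : m = n) : SimplexCategory.mk m ⟶ SimplexCategory.mk n :=
  eqToHom (congrArg SimplexCategory.mk h)

/-! ### Iterated degeneracies and shuffles -/

/-- The operator of the simplicial category inducing `s_{ν_i} … s_{ν_1} : V_n → V_{n+i}`, where
`ν_{r+1}` is `ν r`.  The `(r+1)`-st degeneracy acts on degree `n + r` and makes sense if
`ν r ≤ n + r`; this holds in all the uses below. -/
def degen (n : ℕ) (ν : ℕ → ℕ) : (i : ℕ) → (SimplexCategory.mk (n + i) ⟶ SimplexCategory.mk n)
  | 0 => 𝟙 _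
  | i + 1 => SimplexCategory.σ (Fin.ofNat (n + i + 1) (ν i)) ≫ degen n ν i

/-- The increasing enumeration (starting with index `0`) of a finite set of natural numbers. -/
def enum (s : Finset ℕ) (r : ℕ) : ℕ := Nat.nth (· ∈ s) r

/-- Pairs `(μ, ν)` of increasing sequences of lengths `i` and `j` (given by their sets of values)
whose values have disjoint union `{a, a + 1, …, a + i + j - 1}`. -/
def shuffles (a i j : ℕ) : Finset (Finset ℕ × Finset ℕ) :=
  {p ∈ (Finset.Ico a (a + i + j)).powerset ×ˢ (Finset.Ico a (a + i + j)).powerset |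
    p.1.card = i ∧ p.2.card = j ∧ Disjoint p.1 p.2 ∧ p.1 ∪ p.2 = Finset.Ico a (a + i + j)}

/-- The set `U(q,i)` of pairs `(μ, ν)` of increasing sequences of length `i` with disjoint union
`{q - i, …, q + i - 1}` (for `i ≤ q`). -/
def setU (q i : ℕ) : Finset (Finset ℕ × Finset ℕ) := shuffles (q - i) i i

/-- The subset `V(q,i)` of `U(q,i)` given by `μ_1 = q - i`. -/
def setV (q i : ℕ) : Finset (Finset ℕ × Finset ℕ) :=
  {p ∈ setU q i | enum p.1 0 = q - i}

/-- The explicit formula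
`δ_i(z) = ∑_{(μ, ν) ∈ V(q,i)} s_{ν_i} … s_{ν_1}(z) · s_{μ_i} … s_{μ_1}(z)`. -/
def delta (R : SAlg.{u}) (q i : ℕ) (z : R.deg q) : R.deg (q + i) :=
  ∑ p ∈ setV q i,
    (R.map (degen q (enum p.2) i).op).hom z * (R.map (degen q (enum p.1) i).op).hom z

/-! ### Natural transformations `V_i ⊗ W_j → V_k ⊗ W_l` and their suspension -/

/-- Natural transformations `V_i ⊗ W_j → V_k ⊗ W_l` on pairs of simplicial vector spaces. -/
@[ext]
structure EMTrans (i j k l : ℕ) where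
  /-- The component at a pair of simplicial vector spaces. -/
  app : ∀ V W : SVect.{u},
    (V.deg i ⊗[ZMod 2] W.deg j) →ₗ[ZMod 2] (V.deg k ⊗[ZMod 2] W.deg l)
  natural : ∀ {V V' W W' : SVect.{u}} (f : V ⟶ V') (g : W ⟶ W'),
    TensorProduct.map (SVect.mapDeg f k) (SVect.mapDeg g l) ∘ₗ app V W =
      app V' W' ∘ₗ TensorProduct.map (SVect.mapDeg f i) (SVect.mapDeg g j)

namespace EMTrans

variable {i j k l k' l' : ℕ}

instance : Zero (EMTrans.{u} i j k l) :=
  ⟨⟨fun _ _ => 0, fun _ _ => by simp⟩⟩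

instance : Add (EMTrans.{u} i j k l) :=
  ⟨fun F G => ⟨fun V W => F.app V W + G.app V W, fun f g => by
    rw [LinearMap.comp_add, LinearMap.add_comp, F.natural, G.natural]⟩⟩

instance : AddCommMonoid (EMTrans.{u} i j k l) where
  add_assoc F G H := by
    ext1; funext V W; exact add_assoc (F.app V W) (G.app V W) (H.app V W)
  zero_add F := by ext1; funext V W; exact zero_add (F.app V W)
  add_zero F := by ext1; funext V W; exact add_zero (F.app V W)
  add_comm F G := by ext1; funext V W; exact add_comm (F.app V W) (G.app V W)
  nsmul := nsmulRec

/-- The composite `G ∘ F`. -/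
def comp (G : EMTrans.{u} k l k' l') (F : EMTrans.{u} i j k l) : EMTrans.{u} i j k' l' where
  app V W := G.app V W ∘ₗ F.app V W
  natural f g := by
    rw [← LinearMap.comp_assoc, G.natural, LinearMap.comp_assoc, F.natural,
      LinearMap.comp_assoc]

/-- The natural transformation `a_* ⊗ b_*` given by two operators of the simplicial category. -/
def ofOps (a : SimplexCategory.mk k ⟶ SimplexCategory.mk i)
    (b : SimplexCategory.mk l ⟶ SimplexCategory.mk j) : EMTrans.{u} i j k l where
  app V W := TensorProduct.map (V.act a) (W.act b)
  natural {V V' W W'} f g := by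
    rw [← TensorProduct.map_comp, ← TensorProduct.map_comp]
    have hf : (SVect.mapDeg f k) ∘ₗ V.act a = V'.act a ∘ₗ (SVect.mapDeg f i) :=
      (congrArg ModuleCat.Hom.hom (f.naturality a.op) :)
    have hg : (SVect.mapDeg g l) ∘ₗ W.act b = W'.act b ∘ₗ (SVect.mapDeg g j) :=
      (congrArg ModuleCat.Hom.hom (g.naturality b.op) :)
    rw [hf, hg]

/-- The twist `T F T`, with components `V_i ⊗ W_j ≅ W_j ⊗ V_i → W_l ⊗ V_k ≅ V_k ⊗ W_l`. -/
def twist (F : EMTrans.{u} j i l k) : EMTrans.{u} i j k l where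
  app V W := (TensorProduct.comm (ZMod 2) (W.deg l) (V.deg k)).toLinearMap ∘ₗ F.app W V ∘ₗ
    (TensorProduct.comm (ZMod 2) (V.deg i) (W.deg j)).toLinearMap
  natural {V V' W W'} f g := by
    have h := F.natural g f
    apply TensorProduct.ext'
    intro x y
    have h' := LinearMap.congr_fun h (y ⊗ₜ[ZMod 2] x)
    simp only [LinearMap.comp_apply, TensorProduct.map_tmul] at h'
    simp only [LinearMap.comp_apply, LinearEquiv.coe_coe, TensorProduct.comm_tmul,
      TensorProduct.map_tmul, ← h', TensorProduct.map_comm]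

end EMTrans

/-- The functor `S' : Δ → Δ` with `[n] ↦ [n+1]`, `(S' α)(0) = 0` and
`(S' α)(i) = α(i - 1) + 1` for `i ≥ 1`. -/
def shiftSimplex : SimplexCategory ⥤ SimplexCategory where
  obj n := SimplexCategory.mk (n.len + 1)
  map {m n} α := SimplexCategory.mkHom
    { toFun := Fin.cases 0 fun i => (α.toOrderHom i).succ
      monotone' := by
        intro x y hxy
        induction x using Fin.cases with
        | zero => exact Fin.zero_le _
        | succ x =>
          induction y using Fin.cases with
          | zero => exact absurd hxy (by simp)
          | succ y =>
            simpa using α.toOrderHom.monotone (Fin.succ_le_succ_iff.mp hxy) }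
  map_id n := by
    ext x : 3
    induction x using Fin.cases <;> rfl
  map_comp f g := by
    ext x : 3
    induction x using Fin.cases <;> rfl

/-- The shifted simplicial vector space `S V = V ∘ S`, with `(S V)_n = V_{n+1}`. -/
def SVect.shift (V : SVect.{u}) : SVect.{u} := shiftSimplex.op ⋙ V

/-- The suspension `V_{i+1} ⊗ W_{j+1} = (S V)_i ⊗ (S W)_j → (S V)_k ⊗ (S W)_l =
V_{k+1} ⊗ W_{l+1}` of a natural transformation. -/
def EMTrans.susp {i j k l : ℕ} (F : EMTrans.{u} i j k l) :
    EMTrans.{u} (i + 1) (j + 1) (k + 1) (l + 1) where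
  app V W := F.app V.shift W.shift
  natural {V V' W W'} f g :=
    F.natural (V := V.shift) (V' := V'.shift) (W := W.shift) (W' := W'.shift)
      (Functor.whiskerLeft shiftSimplex.op f) (Functor.whiskerLeft shiftSimplex.op g)

/-! ### EM type transformations with index function `(i,j) ↦ (i+j-k, i+j-k)` -/

/-- Families of natural transformations `V_i ⊗ W_j → V_m ⊗ W_m` with `m = i + j - k`, for all
`i, j` with `i + j - k ≥ 0` (groups in negative degrees being zero by convention). -/
abbrev EMFam (k : ℕ) : Type (u + 1) :=
  ∀ i j m : ℕ, m + k = i + j → EMTrans.{u} i j m m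

namespace EMFam

variable {k : ℕ}

/-- The suspension `S F`, with `(S F)_{i+1,j+1} = S (F_{i,j})` and zero on `V_0 ⊗ W_j` and
`V_i ⊗ W_0`. -/
def susp (F : EMFam.{u} k) : EMFam.{u} (k + 1)
  | i + 1, j + 1, m + 1, h => (F i j m (by omega)).susp
  | _, _, _, _ => 0

/-- The composite `F (d_0 ⊗ id)`; here `d_0` is zero on `V_0`. -/
def d0Left (F : EMFam.{u} k) : EMFam.{u} (k + 1)
  | 0, _, _, _ => 0
  | i + 1, j, m, h => (F i j m (by omega)).comp (EMTrans.ofOps (SimplexCategory.δ 0) (𝟙 _))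

/-- The composite `F (id ⊗ d_0)`; here `d_0` is zero on `W_0`. -/
def d0Right (F : EMFam.{u} k) : EMFam.{u} (k + 1)
  | _, 0, _, _ => 0
  | i, j + 1, m, h => (F i j m (by omega)).comp (EMTrans.ofOps (𝟙 _) (SimplexCategory.δ 0))

/-- The composite `F (id ⊗ s_0)`. -/
def s0Right (F : EMFam.{u} (k + 1)) : EMFam.{u} k :=
  fun i j m h => (F i (j + 1) m (by omega)).comp (EMTrans.ofOps (𝟙 _) (SimplexCategory.σ 0))

/-- The composite `F (∂ ⊗ id)`; here `∂` is zero on `V_0`. -/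
def bdryLeft (F : EMFam.{u} k) : EMFam.{u} (k + 1)
  | 0, _, _, _ => 0
  | i + 1, j, m, h => (F i j m (by omega)).comp
      (∑ r : Fin (i + 2), EMTrans.ofOps (SimplexCategory.δ r) (𝟙 _))

/-- The composite `F (id ⊗ ∂)`; here `∂` is zero on `W_0`. -/
def bdryRight (F : EMFam.{u} k) : EMFam.{u} (k + 1)
  | _, 0, _, _ => 0
  | i, j + 1, m, h => (F i j m (by omega)).comp
      (∑ r : Fin (j + 2), EMTrans.ofOps (𝟙 _) (SimplexCategory.δ r))

/-- The composite `∂ F`, where `∂ = ∑_r d_r ⊗ d_r` is the differential of `C(V ⊗ W)`. -/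
def bdryPost (F : EMFam.{u} k) : EMFam.{u} (k + 1) :=
  fun i j m h =>
    (∑ r : Fin (m + 2), EMTrans.ofOps (SimplexCategory.δ r) (SimplexCategory.δ r)).comp
      (F i j (m + 1) (by omega))

/-- The twist `T F T`. -/
def twist (F : EMFam.{u} k) : EMFam.{u} k :=
  fun i j m h => (F j i m (by omega)).twist

/-- The transformation `φ_k`: the identity of `V_k ⊗ W_k` if `i = j = k` (so that also
`m = k`), and zero otherwise. -/
def phi (k : ℕ) : EMFam.{u} k := fun i j m h =>
  if hk : i = k ∧ j = k then
    EMTrans.ofOps (castOp (by omega : m = i)) (castOp (by omega : m = j))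
  else 0

/-- The Eilenberg-MacLane map
`D_{i,j} = ∑ s_{ν_j} … s_{ν_1} ⊗ s_{μ_i} … s_{μ_1}`, a sum over `(i,j)`-shuffles `(μ, ν)`. -/
def eilenbergMacLane : EMFam.{u} 0 := fun i j m h =>
  ∑ p ∈ shuffles 0 i j,
    EMTrans.ofOps
      (castOp (by omega : m = i + j) ≫ degen i (enum p.2) j)
      (castOp (by omega : m = j + i) ≫ degen j (enum p.1) i)

/-- The recursively defined higher Eilenberg-MacLane maps: `D^0 = S(D) (id ⊗ s_0)`, and for
`k ≥ 1` one has `D^k = S(D^{k-1}) + D^{k-1} (d_0 ⊗ id)` if `k` is even and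
`D^k = S(D^{k-1}) + D^{k-1} (id ⊗ d_0)` if `k` is odd. -/
def higherD : (k : ℕ) → EMFam.{u} k
  | 0 => eilenbergMacLane.susp.s0Right
  | k + 1 => fun i j m h => (higherD k).susp i j m h +
      if Even (k + 1) then (higherD k).d0Left i j m h else (higherD k).d0Right i j m h

end EMFam

/-- Dwyer's conditions on a sequence of higher Eilenberg-MacLane maps `D^0, D^1, …`: in the range
`2k ≤ i + j` one has `D^0 + T D^0 T = D + φ_0` and, for `k ≥ 1`,
`D^k + T D^k T = D^{k-1} ∂ + ∂ D^{k-1} + φ_k` on `V_i ⊗ W_j`.  Nothing is required outside this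
range, where the maps are not used. -/
structure IsHigherEilenbergMacLane (D : (k : ℕ) → EMFam.{u} k) : Prop where
  zero : ∀ (i j m : ℕ) (h : m + 0 = i + j),
    D 0 i j m h + (D 0).twist i j m h =
      EMFam.eilenbergMacLane i j m h + EMFam.phi 0 i j m h
  succ : ∀ (k i j m : ℕ) (h : m + (k + 1) = i + j), 2 * (k + 1) ≤ i + j →
    D (k + 1) i j m h + (D (k + 1)).twist i j m h =
      ((D k).bdryLeft i j m h + (D k).bdryRight i j m h) + (D k).bdryPost i j m h
        + EMFam.phi (k + 1) i j m h

/-! ### The homotopy operations -/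

/-- The multiplication `μ : R_m ⊗ R_m → R_m`. -/
def SAlg.mulMap (R : SAlg.{u}) (m : ℕ) :
    (R.toVect.deg m ⊗[ZMod 2] R.toVect.deg m) →ₗ[ZMod 2] R.toVect.deg m :=
  LinearMap.mul' (ZMod 2) (R.deg m)

/-- Dwyer's element `Θ_i(x) = μ D^{q-i}(x ⊗ x) + μ D^{q-i-1}(x ⊗ ∂x)` of `R_{q+i}`, for `x` in
`R_q` and `i ≤ q`; the second term is absent for `i = q`. -/
def dwyerTheta (D : (k : ℕ) → EMFam.{u} k) (R : SAlg.{u}) (q i : ℕ) (hiq : i ≤ q)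
    (x : R.toVect.deg q) : R.toVect.deg (q + i) :=
  R.mulMap (q + i) ((D (q - i) q q (q + i) (by omega)).app R.toVect R.toVect
    (x ⊗ₜ[ZMod 2] x)) +
  if h : i < q then
    R.mulMap (q + i) ((D (q - i - 1) q (q - 1) (q + i) (by omega)).app R.toVect R.toVect
      (x ⊗ₜ[ZMod 2] R.toVect.bdry q x))
  else 0

/-- A map `π_q R → π_{q+i} R` is the Bousfield-Dwyer operation if, for every choice of higher
Eilenberg-MacLane maps satisfying Dwyer's conditions and every cycle `x` of degree `q` in the
associated chain complex, `Θ_i(x)` is a cycle and the map sends the class of `x` to the class of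
`Θ_i(x)`. -/
def IsBousfieldDwyer (R : SAlg.{u}) (q i : ℕ) (hiq : i ≤ q)
    (f : R.toVect.homotopy q → R.toVect.homotopy (q + i)) : Prop :=
  ∀ D : (k : ℕ) → EMFam.{u} k, IsHigherEilenbergMacLane D →
    ∀ (x : R.toVect.deg q) (hx : x ∈ R.toVect.cycles q),
      ∃ hΘ : dwyerTheta D R q i hiq x ∈ R.toVect.cycles (q + i),
        f (R.toVect.cls q x hx) = R.toVect.cls (q + i) (dwyerTheta D R q i hiq x) hΘ

end

noncomputable section

/-! ### Calculus of operators and of natural transformations -/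

/-! Write [∂,F] = ∂F + F∂ and G = D^0.

Relations. The element 0 lies in exactly one of the two halves of a nonempty shuffle, and the
shuffles with 0 in μ are those produced by S(D)(id ⊗ s_0). Hence D = G + TGT + φ_0
(`eilenbergMacLane_split`), which is the relation for k = 0. Everything else about the D^k follows
formally from this splitting and from two commutation rules: [∂,SF] is S[∂,F] up to terms in d_0
(`bdryComm_susp`), and [∂,F(d_0 ⊗ id)] = [∂,F](d_0 ⊗ id) + F(d_0d_0 ⊗ id). They show by induction
that D is a chain map, then give the relation for k = 1 (`recursion_first`) and the passage from k
to k + 1 (`recursion_step`, and its twist for the other parity).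

Explicit formula. On normalized elements the d_0 terms of the recursion vanish, so D^k acts as the
k-fold suspension of D^0. Suspension translates shuffles by one; for k = q - i the result is the sum
over V(q,i) (`higherD_app_tmul`). An operator missing r does not distinguish a set from the one with
r - 1 and r exchanged, and this exchange cancels the terms of its value on δ_i(z) in pairs
(`delta_mem_normCycles`).

Homotopy. After multiplication T becomes invisible, and the relations show that μD^k(x ⊗ x) is a
cycle whose class depends only on that of x (`emProd_self_add_bdry`). For two choices D, D', the
elements s_k = D^k(z ⊗ z) + D'^k(z ⊗ z) satisfy Ns_0 = 0 and Ns_{k+1} = ∂s_k with N = 1 + T. By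
naturality they may be studied in the simplicial subspace generated by z, which has no homotopy
above degree q. A symmetric tensor is a norm plus some v ⊗ v, and v ⊗ v is additive and compatible
with ∂ modulo norms. So acyclicity makes each s_k a norm plus a boundary (`exists_difference`), and
multiplication kills norms.

Finally every cycle is homologous to a normalized one by the Dold–Kan projection, so the formula on
normalized cycles determines the operation. -/

theorem SVect.act_comp (V : SVect.{u}) {i k l : ℕ} (a : SimplexCategory.mk k ⟶ SimplexCategory.mk i)
    (b : SimplexCategory.mk l ⟶ SimplexCategory.mk k) :
    V.act (b ≫ a) = V.act b ∘ₗ V.act a := by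
  simp [SVect.act]

@[simp]
theorem SVect.act_id (V : SVect.{u}) (i : ℕ) : V.act (𝟙 (SimplexCategory.mk i)) = LinearMap.id := by
  simp [SVect.act]

theorem shiftSimplex_δ {n : ℕ} (r : Fin (n + 2)) :
    shiftSimplex.map (SimplexCategory.δ r) = SimplexCategory.δ r.succ := by
  ext x : 3
  change Fin (n + 2) at x
  change Fin.cases 0 (fun i => (r.succAbove i).succ) x = r.succ.succAbove x
  induction x using Fin.cases with
  | zero => exact (Fin.succ_succAbove_zero r).symm
  | succ x => exact (Fin.succ_succAbove_succ r x).symm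

/-- This is the naturality of d_0 as a map from the shifted object to the original one. -/
theorem δ_zero_shiftSimplex {m n : SimplexCategory} (a : m ⟶ n) :
    SimplexCategory.δ (n := m.len) 0 ≫ shiftSimplex.map a = a ≫ SimplexCategory.δ (n := n.len) 0 := by
  ext x : 3
  rfl

/-- The face operator `d_0`, as a map of simplicial vector spaces from the shift. -/
def SVect.shiftFace (V : SVect.{u}) : V.shift ⟶ V where
  app n := V.map (SimplexCategory.δ (n := n.unop.len) 0).op
  naturality m n a := by
    have h := congrArg (fun t => V.map t.op) (δ_zero_shiftSimplex a.unop)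
    exact (V.map_comp _ _).symm.trans (h.trans (V.map_comp _ _))

@[simp] theorem castOp_self {m : ℕ} (h : m = m) : castOp h = 𝟙 _ := rfl

namespace EMTrans

variable {i j k l k' l' : ℕ}

/-- Cancellation modulo two: an equation holds if the sum of its two sides is twice something. -/
theorem eq_of_add_eq_double {F G : EMTrans.{u} i j k l} (H : EMTrans.{u} i j k l)
    (h : F + G = H + H) : F = G := by
  ext1; funext V W
  apply LinearMap.ext
  intro x
  have h' := LinearMap.congr_fun (congrArg (fun T => T.app V W) h) x
  have h2 : F.app V W x + G.app V W x = 0 := h'.trans (ZModModule.add_self _)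
  rw [eq_neg_of_add_eq_zero_left h2]
  exact ZModModule.neg_eq_self _

@[simp] theorem add_app (F G : EMTrans.{u} i j k l) (V W : SVect.{u}) :
    (F + G).app V W = F.app V W + G.app V W := rfl

@[simp] theorem zero_app (V W : SVect.{u}) : (0 : EMTrans.{u} i j k l).app V W = 0 := rfl

/-- Evaluation of natural transformations, as an additive map. -/
def evalHom (V W : SVect.{u}) : EMTrans.{u} i j k l →+
    ((V.deg i ⊗[ZMod 2] W.deg j) →ₗ[ZMod 2] (V.deg k ⊗[ZMod 2] W.deg l)) where
  toFun F := F.app V W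
  map_zero' := rfl
  map_add' _ _ := rfl

theorem sum_app {ι : Type*} (s : Finset ι) (F : ι → EMTrans.{u} i j k l) (V W : SVect.{u}) :
    (∑ r ∈ s, F r).app V W = ∑ r ∈ s, (F r).app V W :=
  map_sum (evalHom V W) F s

theorem add_self (F : EMTrans.{u} i j k l) : F + F = 0 := by
  ext1; funext V W
  apply LinearMap.ext
  intro x
  exact ZModModule.add_self _

/-- In characteristic two negation is the identity. The group structure gives access to `abel` and
to subtraction lemmas. -/
instance : AddCommGroup (EMTrans.{u} i j k l) where
  neg F := F
  zsmul := @zsmulRec _ _ _ ⟨fun F => F⟩ nsmulRec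
  neg_add_cancel F := add_self F
  add_comm := add_comm

theorem comp_add (G : EMTrans.{u} k l k' l') (F F' : EMTrans.{u} i j k l) :
    G.comp (F + F') = G.comp F + G.comp F' := by
  ext1; funext V W
  exact LinearMap.comp_add _ _ _

theorem add_comp (G G' : EMTrans.{u} k l k' l') (F : EMTrans.{u} i j k l) :
    (G + G').comp F = G.comp F + G'.comp F := by
  ext1; funext V W
  exact LinearMap.add_comp _ _ _

@[simp] theorem comp_zero (G : EMTrans.{u} k l k' l') :
    G.comp (0 : EMTrans.{u} i j k l) = 0 := by
  ext1; funext V W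
  exact LinearMap.comp_zero _

@[simp] theorem zero_comp (F : EMTrans.{u} i j k l) :
    (0 : EMTrans.{u} k l k' l').comp F = 0 := by
  ext1; funext V W
  exact LinearMap.zero_comp _

theorem comp_assoc {m n : ℕ} (H : EMTrans.{u} k' l' m n) (G : EMTrans.{u} k l k' l')
    (F : EMTrans.{u} i j k l) : (H.comp G).comp F = H.comp (G.comp F) := rfl

theorem comp_sum {ι : Type*} (s : Finset ι) (G : EMTrans.{u} k l k' l')
    (F : ι → EMTrans.{u} i j k l) : G.comp (∑ r ∈ s, F r) = ∑ r ∈ s, G.comp (F r) :=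
  map_sum (AddMonoidHom.mk' G.comp (comp_add G)) F s

theorem sum_comp {ι : Type*} (s : Finset ι) (G : ι → EMTrans.{u} k l k' l')
    (F : EMTrans.{u} i j k l) : (∑ r ∈ s, G r).comp F = ∑ r ∈ s, (G r).comp F :=
  map_sum (AddMonoidHom.mk' (fun G : EMTrans.{u} k l k' l' => G.comp F) (fun G G' => add_comp G G' F)) G s

theorem ofOps_comp (a : SimplexCategory.mk k ⟶ SimplexCategory.mk i)
    (b : SimplexCategory.mk l ⟶ SimplexCategory.mk j)
    (a' : SimplexCategory.mk k' ⟶ SimplexCategory.mk k)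
    (b' : SimplexCategory.mk l' ⟶ SimplexCategory.mk l) :
    (ofOps.{u} a' b').comp (ofOps a b) = ofOps (a' ≫ a) (b' ≫ b) := by
  ext1; funext V W
  simp only [comp, ofOps, SVect.act_comp, TensorProduct.map_comp]

@[simp] theorem comp_ofOps_id (F : EMTrans.{u} i j k l) : F.comp (ofOps (𝟙 _) (𝟙 _)) = F := by
  ext1; funext V W
  simp [comp, ofOps]

theorem susp_add (F G : EMTrans.{u} i j k l) : (F + G).susp = F.susp + G.susp := rfl

@[simp] theorem susp_zero : (0 : EMTrans.{u} i j k l).susp = 0 := rfl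

theorem susp_sum {ι : Type*} (s : Finset ι) (F : ι → EMTrans.{u} i j k l) :
    (∑ r ∈ s, F r).susp = ∑ r ∈ s, (F r).susp :=
  map_sum (AddMonoidHom.mk' (fun F : EMTrans.{u} i j k l => F.susp) susp_add) F s

theorem susp_comp (G : EMTrans.{u} k l k' l') (F : EMTrans.{u} i j k l) :
    (G.comp F).susp = G.susp.comp F.susp := rfl

theorem susp_ofOps (a : SimplexCategory.mk k ⟶ SimplexCategory.mk i)
    (b : SimplexCategory.mk l ⟶ SimplexCategory.mk j) :
    (ofOps.{u} a b).susp = ofOps (shiftSimplex.map a) (shiftSimplex.map b) := rfl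

theorem susp_twist (F : EMTrans.{u} j i l k) : F.twist.susp = F.susp.twist := rfl

/-- Naturality of F with respect to the simplicial maps d_0 : SV → V and d_0 : SW → W. -/
theorem face_comp_susp (F : EMTrans.{u} i j k l) :
    (ofOps (SimplexCategory.δ 0) (SimplexCategory.δ 0)).comp F.susp =
      F.comp (ofOps (SimplexCategory.δ 0) (SimplexCategory.δ 0)) := by
  ext1; funext V W
  exact F.natural V.shiftFace W.shiftFace

theorem twist_add (F G : EMTrans.{u} j i l k) : (F + G).twist = F.twist + G.twist := by
  ext1; funext V W
  simp [twist, LinearMap.add_comp, LinearMap.comp_add]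

@[simp] theorem twist_zero : (0 : EMTrans.{u} j i l k).twist = 0 := by
  ext1; funext V W
  simp [twist]

theorem twist_sum {ι : Type*} (s : Finset ι) (F : ι → EMTrans.{u} i j k l) :
    (∑ r ∈ s, F r).twist = ∑ r ∈ s, (F r).twist :=
  map_sum (AddMonoidHom.mk' (fun F : EMTrans.{u} i j k l => F.twist) twist_add) F s

@[simp] theorem twist_twist (F : EMTrans.{u} i j k l) : F.twist.twist = F := by
  ext1; funext V W
  apply LinearMap.ext
  intro x
  simp [twist]

theorem twist_comp (G : EMTrans.{u} k l k' l') (F : EMTrans.{u} i j k l) :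
    (G.comp F).twist = G.twist.comp F.twist := by
  ext1; funext V W
  apply LinearMap.ext
  intro x
  simp [twist, comp]

@[simp] theorem twist_ofOps (a : SimplexCategory.mk k ⟶ SimplexCategory.mk i)
    (b : SimplexCategory.mk l ⟶ SimplexCategory.mk j) :
    (ofOps.{u} a b).twist = ofOps b a := by
  ext1; funext V W
  apply TensorProduct.ext'
  intro x y
  simp [twist, ofOps]

end EMTrans

/-! ### Families: twist, commutator with ∂, and their interaction with S, d_0 and s_0. -/

namespace EMFam

variable {k : ℕ}

instance : Add (EMFam.{u} k) := ⟨fun F G i j m h => F i j m h + G i j m h⟩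

theorem add_apply (F G : EMFam.{u} k) (i j m : ℕ) (h : m + k = i + j) :
    (F + G) i j m h = F i j m h + G i j m h := rfl

/-- The commutator `∂ F + F ∂`. -/
def bdryComm (F : EMFam.{u} k) : EMFam.{u} (k + 1) := fun i j m h =>
  (F.bdryLeft i j m h + F.bdryRight i j m h) + F.bdryPost i j m h

@[simp] theorem susp_zero_left (F : EMFam.{u} k) (j m : ℕ) (h) : F.susp 0 j m h = 0 := rfl

@[simp] theorem susp_zero_right (F : EMFam.{u} k) (i m : ℕ) (h) : F.susp i 0 m h = 0 := by
  cases i <;> rfl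

@[simp] theorem susp_succ (F : EMFam.{u} k) (i j m : ℕ) (h) :
    F.susp (i + 1) (j + 1) (m + 1) h = (F i j m (by omega)).susp := rfl

@[simp] theorem d0Left_zero (F : EMFam.{u} k) (j m : ℕ) (h) : F.d0Left 0 j m h = 0 := rfl

@[simp] theorem d0Left_succ (F : EMFam.{u} k) (i j m : ℕ) (h) : F.d0Left (i + 1) j m h =
    (F i j m (by omega)).comp (EMTrans.ofOps (SimplexCategory.δ 0) (𝟙 _)) := rfl

@[simp] theorem d0Right_zero (F : EMFam.{u} k) (i m : ℕ) (h) : F.d0Right i 0 m h = 0 := by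
  cases i <;> rfl

@[simp] theorem d0Right_succ (F : EMFam.{u} k) (i j m : ℕ) (h) : F.d0Right i (j + 1) m h =
    (F i j m (by omega)).comp (EMTrans.ofOps (𝟙 _) (SimplexCategory.δ 0)) := by
  cases i <;> rfl

@[simp] theorem bdryLeft_zero (F : EMFam.{u} k) (j m : ℕ) (h) : F.bdryLeft 0 j m h = 0 := rfl

@[simp] theorem bdryLeft_succ (F : EMFam.{u} k) (i j m : ℕ) (h) : F.bdryLeft (i + 1) j m h =
    (F i j m (by omega)).comp
      (∑ r : Fin (i + 2), EMTrans.ofOps (SimplexCategory.δ r) (𝟙 _)) := rfl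

@[simp] theorem bdryRight_zero (F : EMFam.{u} k) (i m : ℕ) (h) : F.bdryRight i 0 m h = 0 := by
  cases i <;> rfl

@[simp] theorem bdryRight_succ (F : EMFam.{u} k) (i j m : ℕ) (h) : F.bdryRight i (j + 1) m h =
    (F i j m (by omega)).comp
      (∑ r : Fin (j + 2), EMTrans.ofOps (𝟙 _) (SimplexCategory.δ r)) := by
  cases i <;> rfl

theorem twist_susp (F : EMFam.{u} k) : F.susp.twist = F.twist.susp := by
  funext i j m h
  rcases i with _ | i <;> rcases j with _ | j <;> rcases m with _ | m <;>
    simp [twist, susp, EMTrans.susp_twist]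

theorem twist_d0Left (F : EMFam.{u} k) : F.d0Left.twist = F.twist.d0Right := by
  funext i j m h
  rcases j with _ | j <;> simp [twist, EMTrans.twist_comp]

theorem twist_d0Right (F : EMFam.{u} k) : F.d0Right.twist = F.twist.d0Left := by
  funext i j m h
  rcases i with _ | i <;> simp [twist, EMTrans.twist_comp]

theorem twist_bdryComm (F : EMFam.{u} k) : F.bdryComm.twist = F.twist.bdryComm := by
  funext i j m h
  have h1 : F.bdryLeft.twist i j m h = F.twist.bdryRight i j m h := by
    rcases j with _ | j <;> simp [twist, EMTrans.twist_comp, EMTrans.twist_sum]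
  have h2 : F.bdryRight.twist i j m h = F.twist.bdryLeft i j m h := by
    rcases i with _ | i <;> simp [twist, EMTrans.twist_comp, EMTrans.twist_sum]
  have h3 : F.bdryPost.twist i j m h = F.twist.bdryPost i j m h := by
    simp [twist, bdryPost, EMTrans.twist_comp, EMTrans.twist_sum]
  have h4 : F.bdryComm.twist i j m h = F.bdryLeft.twist i j m h + F.bdryRight.twist i j m h
      + F.bdryPost.twist i j m h := by
    simp [twist, bdryComm, EMTrans.twist_add]
  rw [h4, h1, h2, h3, bdryComm, add_comm (F.twist.bdryRight i j m h)]

theorem twist_add (F G : EMFam.{u} k) : (F + G).twist = F.twist + G.twist := by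
  funext i j m h
  exact EMTrans.twist_add _ _

@[simp] theorem twist_twist (F : EMFam.{u} k) : F.twist.twist = F := by
  funext i j m h
  simp [twist]

/-- The suspension anticommutes with the differential up to terms involving `d_0`. -/
theorem bdryComm_susp (F : EMFam.{u} k) (i j m : ℕ) (h : m + 1 + (k + 1 + 1) = i + j) :
    F.susp.bdryComm i j (m + 1) h = F.bdryComm.susp i j (m + 1) h +
      F.d0Left.d0Right i j (m + 1) h + F.susp.d0Left i j (m + 1) h
      + F.susp.d0Right i j (m + 1) h := by
  -- The suspended differential consists of the faces d_1, d_2, …, so each of the three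
  -- differentials leaves over its d_0 term.
  have h1 : F.susp.bdryLeft i j (m + 1) h =
      F.bdryLeft.susp i j (m + 1) h + F.susp.d0Left i j (m + 1) h := by
    rcases i with _ | _ | i <;> rcases j with _ | j <;>
      simp [Fin.sum_univ_succ (n := _ + 2), EMTrans.comp_add, EMTrans.susp_comp,
        EMTrans.susp_sum, EMTrans.susp_ofOps, shiftSimplex_δ]
    exact add_comm _ _
  have h2 : F.susp.bdryRight i j (m + 1) h =
      F.bdryRight.susp i j (m + 1) h + F.susp.d0Right i j (m + 1) h := by
    rcases i with _ | i <;> rcases j with _ | _ | j <;>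
      simp [Fin.sum_univ_succ (n := _ + 2), EMTrans.comp_add, EMTrans.susp_comp,
        EMTrans.susp_sum, EMTrans.susp_ofOps, shiftSimplex_δ]
    exact add_comm _ _
  -- Here the leftover (d_0 ⊗ d_0)SF equals F(d_0 ⊗ d_0) by naturality. The target degree must be
  -- positive: in degree 0 the suspension of ∂F is zero by convention and would lose d_1 ⊗ d_1.
  have h3 : F.susp.bdryPost i j (m + 1) h =
      F.bdryPost.susp i j (m + 1) h + F.d0Left.d0Right i j (m + 1) h := by
    rcases i with _ | i <;> rcases j with _ | j <;>
      simp [bdryPost, Fin.sum_univ_succ (n := _ + 2), EMTrans.add_comp, EMTrans.susp_comp,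
        EMTrans.susp_sum, EMTrans.susp_ofOps, shiftSimplex_δ, EMTrans.face_comp_susp,
        EMTrans.comp_assoc, EMTrans.ofOps_comp]
    exact add_comm _ _
  have h4 : F.bdryComm.susp i j (m + 1) h = F.bdryLeft.susp i j (m + 1) h
      + F.bdryRight.susp i j (m + 1) h + F.bdryPost.susp i j (m + 1) h := by
    rcases i with _ | i <;> rcases j with _ | j <;> simp [bdryComm, EMTrans.susp_add]
  rw [bdryComm, h1, h2, h3, h4]
  abel

theorem d0Left_add (F G : EMFam.{u} k) : (F + G).d0Left = F.d0Left + G.d0Left := by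
  funext i j m h
  rcases i with _ | i <;> simp [EMTrans.add_comp, add_apply]

theorem d0Right_add (F G : EMFam.{u} k) : (F + G).d0Right = F.d0Right + G.d0Right := by
  funext i j m h
  rcases j with _ | j <;> simp [EMTrans.add_comp, add_apply]

theorem susp_add (F G : EMFam.{u} k) : (F + G).susp = F.susp + G.susp := by
  funext i j m h
  rcases i with _ | i <;> rcases j with _ | j <;> rcases m with _ | m <;>
    rfl

theorem bdryComm_add (F G : EMFam.{u} k) : (F + G).bdryComm = F.bdryComm + G.bdryComm := by
  funext i j m h
  have h1 : (F + G).bdryLeft i j m h = F.bdryLeft i j m h + G.bdryLeft i j m h := by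
    rcases i with _ | i <;> simp [EMTrans.add_comp, add_apply]
  have h2 : (F + G).bdryRight i j m h = F.bdryRight i j m h + G.bdryRight i j m h := by
    rcases j with _ | j <;> simp [EMTrans.add_comp, add_apply]
  have h3 : (F + G).bdryPost i j m h = F.bdryPost i j m h + G.bdryPost i j m h := by
    simp [bdryPost, EMTrans.comp_add, add_apply]
  simp only [bdryComm, h1, h2, h3, add_apply]
  abel

/-- The relation `d_0 ∂ = ∂ d_0 + d_0 d_0`, on operators. -/
theorem sum_δ_comp_δ_zero (n : ℕ) {M : Type*} [AddCommMonoid M]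
    (f : (SimplexCategory.mk n ⟶ SimplexCategory.mk (n + 2)) → M) :
    ∑ r : Fin (n + 3), f (SimplexCategory.δ 0 ≫ SimplexCategory.δ r) =
      f (SimplexCategory.δ 0 ≫ SimplexCategory.δ 0) +
        ∑ r : Fin (n + 2), f (SimplexCategory.δ r ≫ SimplexCategory.δ 0) := by
  rw [Fin.sum_univ_succ]
  congr 1
  refine Finset.sum_congr rfl fun r _ => ?_
  rw [SimplexCategory.δ_comp_δ (Fin.zero_le r)]
  rfl

/-- Only the differential of the left factor fails to commute with d_0 ⊗ id, and d_0∂ = ∂d_0 +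
d_0d_0 measures the failure. -/
theorem bdryComm_d0Left (F : EMFam.{u} k) :
    F.d0Left.bdryComm = F.bdryComm.d0Left + F.d0Left.d0Left := by
  funext i j m h
  have h2 : F.d0Left.bdryRight i j m h = F.bdryRight.d0Left i j m h := by
    rcases i with _ | i <;> rcases j with _ | j <;>
      simp [EMTrans.comp_assoc, EMTrans.ofOps_comp, EMTrans.comp_sum, EMTrans.sum_comp]
  have h3 : F.d0Left.bdryPost i j m h = F.bdryPost.d0Left i j m h := by
    rcases i with _ | i <;> simp [bdryPost, EMTrans.comp_assoc]
  have h1 : F.d0Left.bdryLeft i j m h = F.bdryLeft.d0Left i j m h + F.d0Left.d0Left i j m h := by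
    rcases i with _ | _ | i
    · simp
    · simp
    · have := sum_δ_comp_δ_zero i
        (fun a => (F i j m (by omega)).comp (EMTrans.ofOps a (𝟙 (SimplexCategory.mk j))))
      simp only [bdryLeft_succ, d0Left_succ, EMTrans.comp_assoc, EMTrans.ofOps_comp,
        EMTrans.comp_sum, EMTrans.sum_comp, Category.comp_id]
      exact this.trans (add_comm _ _)
  have h4 : F.bdryComm.d0Left i j m h = F.bdryLeft.d0Left i j m h
      + F.bdryRight.d0Left i j m h + F.bdryPost.d0Left i j m h := by
    rcases i with _ | i <;> simp [bdryComm, EMTrans.add_comp]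
  rw [add_apply, bdryComm, h1, h2, h3, h4]
  abel

theorem s0Right_d0Left (F : EMFam.{u} (k + 1)) : F.d0Left.s0Right = F.s0Right.d0Left := by
  funext i j m h
  rcases i with _ | i <;> simp [s0Right, EMTrans.comp_assoc, EMTrans.ofOps_comp]

theorem s0Right_d0Right (F : EMFam.{u} k) : F.d0Right.s0Right = F := by
  funext i j m h
  have := SimplexCategory.δ_comp_σ_self (n := j) (i := 0)
  rw [Fin.castSucc_zero] at this
  simp [s0Right, EMTrans.comp_assoc, EMTrans.ofOps_comp, this]

/-- The relation `∂ s_0 = s_0 ∂ + s_0 d_0` modulo two, on operators. -/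
theorem sum_δ_comp_σ_zero (n : ℕ) {M : Type*} [AddCommGroup M] (h2 : ∀ x : M, x + x = 0)
    (f : (SimplexCategory.mk (n + 1) ⟶ SimplexCategory.mk (n + 1)) → M) :
    ∑ r : Fin (n + 3), f (SimplexCategory.δ r ≫ SimplexCategory.σ 0) =
      f (SimplexCategory.σ 0 ≫ SimplexCategory.δ 0) +
        ∑ r : Fin (n + 2), f (SimplexCategory.σ 0 ≫ SimplexCategory.δ r) := by
  have e0 := SimplexCategory.δ_comp_σ_self (n := n + 1) (i := 0)
  have e1 := SimplexCategory.δ_comp_σ_succ (n := n + 1) (i := 0)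
  rw [Fin.castSucc_zero] at e0
  rw [Fin.sum_univ_succ, Fin.sum_univ_succ, e0, e1, ← add_assoc, h2, zero_add,
    Fin.sum_univ_succ (n := n + 1), ← add_assoc, h2, zero_add]
  refine Finset.sum_congr rfl fun r _ => ?_
  congr 1
  exact SimplexCategory.δ_comp_σ_of_gt (i := r.succ) (j := 0) (Fin.succ_pos r)

theorem bdryComm_s0Right (F : EMFam.{u} (k + 1)) :
    F.s0Right.bdryComm = F.bdryComm.s0Right + F.s0Right.d0Right := by
  funext i j m h
  have h1 : F.s0Right.bdryLeft i j m h = F.bdryLeft.s0Right i j m h := by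
    rcases i with _ | i <;> simp [s0Right, EMTrans.comp_assoc, EMTrans.ofOps_comp,
      EMTrans.comp_sum, EMTrans.sum_comp]
  have h3 : F.s0Right.bdryPost i j m h = F.bdryPost.s0Right i j m h := by
    simp [bdryPost, s0Right, EMTrans.comp_assoc]
  have h2 : F.bdryRight.s0Right i j m h =
      F.s0Right.bdryRight i j m h + F.s0Right.d0Right i j m h := by
    -- On W_0 both ∂ and d_0 are zero by convention, and d_0s_0 + d_1s_0 = 0.
    rcases j with _ | j
    · have e0 := SimplexCategory.δ_comp_σ_self (n := 0) (i := 0)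
      have e1 := SimplexCategory.δ_comp_σ_succ (n := 0) (i := 0)
      rw [Fin.castSucc_zero] at e0
      rw [Fin.succ_zero_eq_one] at e1
      simp [s0Right, EMTrans.comp_assoc, EMTrans.ofOps_comp, Fin.sum_univ_two, EMTrans.add_comp,
        EMTrans.comp_add, e0, e1, EMTrans.add_self]
    · have := sum_δ_comp_σ_zero j EMTrans.add_self
        (fun a => (F i (j + 1) m (by omega)).comp (EMTrans.ofOps (𝟙 (SimplexCategory.mk i)) a))
      simp only [s0Right, bdryRight_succ, d0Right_succ, EMTrans.comp_assoc, EMTrans.ofOps_comp,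
        EMTrans.comp_sum, EMTrans.sum_comp, Category.comp_id]
      rw [this]
      exact add_comm _ _
  have h4 : F.bdryComm.s0Right i j m h = F.bdryLeft.s0Right i j m h
      + F.bdryRight.s0Right i j m h + F.bdryPost.s0Right i j m h := by
    simp [bdryComm, s0Right, EMTrans.add_comp]
  rw [add_apply, bdryComm, h1, h3, h4, h2]
  -- `abel` does not reduce coefficients modulo two, so the terms that occur twice are listed
  -- explicitly here and in later uses.
  exact EMTrans.eq_of_add_eq_double (F.bdryLeft.s0Right i j m h + F.s0Right.bdryRight i j m h
    + F.bdryPost.s0Right i j m h + F.s0Right.d0Right i j m h) (by abel)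

theorem susp_phi : (phi.{u} k).susp = phi (k + 1) := by
  funext i j m h
  rcases i with _ | i
  · simp [phi]
  rcases j with _ | j
  · simp [phi]
  rcases m with _ | m
  · simp [phi]
    simp [susp]
    omega
  by_cases hk : i = k ∧ j = k
  · obtain ⟨hi, hj⟩ := hk
    have hm : m = k := by omega
    subst hi hj hm
    simp [phi, EMTrans.susp_ofOps]
    rfl
  · rw [susp_succ, phi, dif_neg hk, phi, dif_neg (by omega), EMTrans.susp_zero]

theorem phi_eq_zero (i j m : ℕ) (h : m + k = i + j) (hk : 2 * k < i + j) :
    phi.{u} k i j m h = 0 :=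
  dif_neg (by omega)

theorem twist_phi : (phi.{u} k).twist = phi k := by
  funext i j m h
  by_cases hk : i = k ∧ j = k
  · simp [twist, phi, hk]
  · rw [twist, phi, dif_neg (by omega), phi, dif_neg hk, EMTrans.twist_zero]

end EMFam

/-! ### The recursion preserves Dwyer's relations. -/

namespace EMFam

variable {k : ℕ}

/-- Equality of two families on all `V_i ⊗ W_j` with `i + j ≥ n`. -/
def EqFrom (n : ℕ) (F G : EMFam.{u} k) : Prop :=
  ∀ (i j m : ℕ) (h : m + k = i + j), n ≤ i + j → F i j m h = G i j m h

/-- Suspension moves the range by two, in step with the bound 2k ≤ i + j as k grows by one. -/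
theorem EqFrom.susp {n : ℕ} {F G : EMFam.{u} k} (H : EqFrom n F G) :
    EqFrom (n + 2) F.susp G.susp := by
  intro i j m h hn
  rcases i with _ | i <;> rcases j with _ | j <;> rcases m with _ | m <;> try rfl
  rw [susp_succ, susp_succ, H _ _ _ _ (by omega)]

theorem EqFrom.d0Left {n : ℕ} {F G : EMFam.{u} k} (H : EqFrom n F G) :
    EqFrom (n + 1) F.d0Left G.d0Left := by
  intro i j m h hn
  rcases i with _ | i
  · rfl
  rw [d0Left_succ, d0Left_succ, H _ _ _ _ (by omega)]

theorem EqFrom.twist {n : ℕ} {F G : EMFam.{u} k} (H : EqFrom n F G) :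
    EqFrom n F.twist G.twist := by
  intro i j m h hn
  rw [EMFam.twist, EMFam.twist, H _ _ _ _ (by omega)]

/-- One step of the recursion; `G` and `K` play the roles of `D^k` and `D^{k+1}` for odd `k`. -/
theorem recursion_step {F : EMFam.{u} k} {G : EMFam.{u} (k + 1)} {K : EMFam.{u} (k + 2)}
    (hG : G = F.susp + F.d0Left) (hK : K = G.susp + G.d0Right)
    (H : EqFrom (2 * (k + 1)) (G + G.twist) (F.bdryComm + phi (k + 1))) :
    EqFrom (2 * (k + 2)) (K + K.twist) (G.bdryComm + phi (k + 2)) := by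
  intro i j m h hn
  -- The range 2(k + 2) ≤ i + j forces a positive target degree, as `bdryComm_susp` needs.
  obtain ⟨m, rfl⟩ : ∃ m', m = m' + 1 := ⟨m - 1, by omega⟩
  -- K + TKT = S(G + TGT) + G(id ⊗ d_0) + TGT(d_0 ⊗ id). The suspended relation rewrites the first
  -- term, and the relation composed with d_0 ⊗ id trades TGT for G in the last one.
  have e1 := H.susp i j (m + 1) h (by omega)
  have e2 := H.d0Left i j (m + 1) h (by omega)
  -- After one face the total degree is still at least 2k + 3, beyond the place where φ_{k+1} lives.
  have hφ : (phi.{u} (k + 1)).d0Left i j (m + 1) h = 0 := by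
    rcases i with _ | i
    · rfl
    · rw [d0Left_succ, phi_eq_zero _ _ _ _ (by omega), EMTrans.zero_comp]
  have hB : G.bdryComm i j (m + 1) h = F.susp.bdryComm i j (m + 1) h +
      F.d0Left.bdryComm i j (m + 1) h := by rw [hG, bdryComm_add, add_apply]
  have hS : F.d0Left.bdryComm i j (m + 1) h =
      F.bdryComm.d0Left i j (m + 1) h + F.d0Left.d0Left i j (m + 1) h := by
    rw [bdryComm_d0Left, add_apply]
  have hR : G.d0Right i j (m + 1) h =
      F.susp.d0Right i j (m + 1) h + F.d0Left.d0Right i j (m + 1) h := by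
    rw [hG, d0Right_add, add_apply]
  have hL : G.d0Left i j (m + 1) h =
      F.susp.d0Left i j (m + 1) h + F.d0Left.d0Left i j (m + 1) h := by
    rw [hG, d0Left_add, add_apply]
  have hT : K.twist i j (m + 1) h =
      G.twist.susp i j (m + 1) h + G.twist.d0Left i j (m + 1) h := by
    rw [hK, twist_add, twist_susp, twist_d0Right, add_apply]
  have hK' : K i j (m + 1) h = G.susp i j (m + 1) h + G.d0Right i j (m + 1) h := by
    rw [hK, add_apply]
  rw [susp_add, susp_add, susp_phi, add_apply, add_apply] at e1
  rw [d0Left_add, d0Left_add, add_apply, add_apply, hφ, add_zero] at e2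
  rw [add_apply, add_apply, hB, hS, bdryComm_susp, hK', hT, hR]
  rw [hL] at e2
  have e1' := eq_sub_of_add_eq e1
  have e2' := eq_sub_of_add_eq' e2
  rw [e1', e2']
  exact EMTrans.eq_of_add_eq_double (F.bdryComm.susp i j (m + 1) h + phi (k + 2) i j (m + 1) h
    + F.susp.d0Right i j (m + 1) h + F.d0Left.d0Right i j (m + 1) h
    + F.bdryComm.d0Left i j (m + 1) h) (by abel)

/-- Both ∂ and φ are compatible with T, so the relation survives conjugation, which exchanges the
two forms of the recursion. -/
theorem EqFrom.twist_step {F : EMFam.{u} k} {G : EMFam.{u} (k + 1)}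
    (H : EqFrom (2 * (k + 1)) (G + G.twist) (F.bdryComm + phi (k + 1))) :
    EqFrom (2 * (k + 1)) (G.twist + G.twist.twist) (F.twist.bdryComm + phi (k + 1)) := by
  have := H.twist
  rwa [EMFam.twist_add, EMFam.twist_add, twist_bdryComm, twist_phi] at this

/-- The recursion step with the roles of the two faces exchanged. -/
theorem recursion_step' {F : EMFam.{u} k} {G : EMFam.{u} (k + 1)} {K : EMFam.{u} (k + 2)}
    (hG : G = F.susp + F.d0Right) (hK : K = G.susp + G.d0Left)
    (H : EqFrom (2 * (k + 1)) (G + G.twist) (F.bdryComm + phi (k + 1))) :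
    EqFrom (2 * (k + 2)) (K + K.twist) (G.bdryComm + phi (k + 2)) := by
  have hG' : G.twist = F.twist.susp + F.twist.d0Left := by
    rw [hG, EMFam.twist_add, twist_susp, twist_d0Right]
  have hK' : K.twist = G.twist.susp + G.twist.d0Right := by
    rw [hK, EMFam.twist_add, twist_susp, twist_d0Left]
  have := (recursion_step hG' hK' H.twist_step).twist_step
  simpa only [twist_twist] using this


theorem d0Left_phi_zero (i j m : ℕ) (h : m + 1 = i + j) (hij : 2 ≤ i + j) :
    (phi.{u} 0).d0Left i j m h = 0 := by
  rcases i with _ | i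
  · rfl
  · rw [d0Left_succ, phi_eq_zero _ _ _ _ (by omega), EMTrans.zero_comp]

theorem d0Right_phi_zero (i j m : ℕ) (h : m + 1 = i + j) (hij : 2 ≤ i + j) :
    (phi.{u} 0).d0Right i j m h = 0 := by
  rcases j with _ | j
  · exact d0Right_zero _ _ _ _
  · rw [d0Right_succ, phi_eq_zero _ _ _ _ (by omega), EMTrans.zero_comp]

theorem bdryComm_phi_zero (i j m : ℕ) (h : m + 1 = i + j) (hij : 2 ≤ i + j) :
    (phi.{u} 0).bdryComm i j m h = 0 := by
  have h1 : (phi.{u} 0).bdryLeft i j m h = 0 := by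
    rcases i with _ | i
    · rfl
    · rw [bdryLeft_succ, phi_eq_zero _ _ _ _ (by omega), EMTrans.zero_comp]
  have h2 : (phi.{u} 0).bdryRight i j m h = 0 := by
    rcases j with _ | j
    · exact bdryRight_zero _ _ _ _
    · rw [bdryRight_succ, phi_eq_zero _ _ _ _ (by omega), EMTrans.zero_comp]
  have h3 : (phi.{u} 0).bdryPost i j m h = 0 := by
    rw [bdryPost, phi_eq_zero _ _ _ _ (by omega), EMTrans.comp_zero]
  rw [bdryComm, h1, h2, h3, add_zero, add_zero]

/-- Combines the rules for S and s_0. Since d_0s_0 = id, two of the d_0 terms lose their right-hand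
face: they become F(d_0 ⊗ id) and SF. -/
theorem bdryComm_susp_s0Right (F : EMFam.{u} k) (i j m : ℕ) (h : m + 1 + (k + 1) = i + j) :
    F.susp.s0Right.bdryComm i j (m + 1) h =
      F.bdryComm.susp.s0Right i j (m + 1) h + F.d0Left i j (m + 1) h
        + F.susp.s0Right.d0Left i j (m + 1) h + F.susp i j (m + 1) h
        + F.susp.s0Right.d0Right i j (m + 1) h := by
  have e : F.susp.bdryComm.s0Right i j (m + 1) h =
      F.bdryComm.susp.s0Right i j (m + 1) h + F.d0Left.d0Right.s0Right i j (m + 1) h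
        + F.susp.d0Left.s0Right i j (m + 1) h + F.susp.d0Right.s0Right i j (m + 1) h := by
    simp only [s0Right, bdryComm_susp, EMTrans.add_comp]
  rw [s0Right_d0Right, s0Right_d0Right, s0Right_d0Left] at e
  rw [bdryComm_s0Right, add_apply, e]

variable {F : EMFam.{u} 0}

theorem twist_eq_of_split (hF : F = F.susp.s0Right + F.susp.s0Right.twist + phi 0) :
    F.twist = F := by
  rw [hF]
  generalize F.susp.s0Right = G
  funext i j m h
  simp only [twist_add, twist_phi, twist_twist, add_apply]
  abel

/-- The splitting alone forces F to be a chain map. By induction S[∂,F] = 0, so with G = S(F)(id ⊗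
s_0) the commutator [∂,G] is F(d_0 ⊗ id) + SF + G(d_0 ⊗ id) + G(id ⊗ d_0). Adding its twist cancels
SF, and the rest cancels because F = G + TGT away from φ_0. -/
theorem bdryComm_eq_zero_of_split (hF : F = F.susp.s0Right + F.susp.s0Right.twist + phi 0)
    (i j m : ℕ) (h : m + 1 = i + j) : F.bdryComm i j m h = 0 := by
  have hT := twist_eq_of_split hF
  induction m generalizing i j with
  | zero =>
    -- In total degree one the φ_0 terms need not vanish, so this case is computed from F_{0,0} = id
    -- and F_{1,0} = id ⊗ s_0.
    have key : ∀ h, F.bdryComm 1 0 0 h = 0 := by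
      intro h
      have e0 : F 0 0 0 rfl = EMTrans.ofOps (𝟙 _) (𝟙 _) := by
        have := congrFun (congrFun (congrFun (congrFun hF 0) 0) 0) rfl
        simpa [add_apply, s0Right, twist, phi] using this
      have e1 : F 1 0 1 rfl = EMTrans.ofOps (𝟙 _) (SimplexCategory.σ 0) := by
        have := congrFun (congrFun (congrFun (congrFun hF 1) 0) 1) rfl
        rw [add_apply, add_apply] at this
        simp [s0Right, twist, phi, e0, EMTrans.susp_ofOps] at this
        rw [this]
        exact EMTrans.ofOps_comp _ _ _ _
      have c0 := SimplexCategory.δ_comp_σ_self (n := 0) (i := 0)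
      have c1 := SimplexCategory.δ_comp_σ_succ (n := 0) (i := 0)
      rw [Fin.castSucc_zero] at c0
      rw [Fin.succ_zero_eq_one] at c1
      simp [bdryComm, bdryPost, e0, e1, EMTrans.ofOps_comp,
        Fin.sum_univ_two, EMTrans.add_comp, EMTrans.comp_add, c0, c1, EMTrans.add_self]
    rcases i with _ | i
    · obtain rfl : j = 1 := by omega
      have := congrArg EMTrans.twist (key rfl)
      rw [EMTrans.twist_zero] at this
      calc F.bdryComm 0 1 0 h = F.twist.bdryComm 0 1 0 h := by rw [hT]
        _ = F.bdryComm.twist 0 1 0 h := by rw [twist_bdryComm]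
        _ = 0 := this
    · obtain rfl : i = 0 := by omega
      obtain rfl : j = 0 := by omega
      exact key h
  | succ m ih =>
    have hz : ∀ i j (h : m + 1 + 1 = i + j), F.bdryComm.susp.s0Right i j (m + 1) h = 0 := by
      intro i j h
      rcases i with _ | i
      · simp [s0Right]
      · simp [s0Right, ih]
    have hG0 : ∀ i j h, F.susp.s0Right.bdryComm i j (m + 1) h = F.d0Left i j (m + 1) h
        + F.susp.s0Right.d0Left i j (m + 1) h + F.susp i j (m + 1) h
        + F.susp.s0Right.d0Right i j (m + 1) h := by
      intro i j h
      rw [bdryComm_susp_s0Right, hz, zero_add]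
    have hG := hG0 i j h
    have hG' := congrArg EMTrans.twist (hG0 j i (h.trans (add_comm i j)))
    simp only [EMTrans.twist_add] at hG'
    change F.susp.s0Right.bdryComm.twist i j (m + 1) h = F.d0Left.twist i j (m + 1) h
      + F.susp.s0Right.d0Left.twist i j (m + 1) h + F.susp.twist i j (m + 1) h
      + F.susp.s0Right.d0Right.twist i j (m + 1) h at hG'
    rw [twist_bdryComm, twist_d0Left, twist_d0Left, twist_d0Right, twist_susp, hT] at hG'
    have hB := congrFun (congrFun (congrFun (congrFun (congrArg bdryComm hF) i) j) (m + 1)) h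
    rw [bdryComm_add, bdryComm_add, add_apply, add_apply, hG, hG',
      bdryComm_phi_zero _ _ _ _ (by omega), add_zero] at hB
    have hL := congrFun (congrFun (congrFun (congrFun (congrArg d0Left hF) i) j) (m + 1)) h
    have hR := congrFun (congrFun (congrFun (congrFun (congrArg d0Right hF) i) j) (m + 1)) h
    rw [d0Left_add, d0Left_add, add_apply, add_apply, d0Left_phi_zero _ _ _ _ (by omega),
      add_zero] at hL
    rw [d0Right_add, d0Right_add, add_apply, add_apply, d0Right_phi_zero _ _ _ _ (by omega),
      add_zero] at hR
    rw [hB, hL, hR]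
    refine EMTrans.eq_of_add_eq_double (F.susp.s0Right.d0Left i j (m + 1) h +
      F.susp.s0Right.d0Right i j (m + 1) h + F.susp.s0Right.twist.d0Left i j (m + 1) h +
      F.susp.s0Right.twist.d0Right i j (m + 1) h + F.susp i j (m + 1) h) ?_
    abel

/-- Since F is a chain map, [∂,G] is given by `bdryComm_susp_s0Right` without its first term.
Substituting the splitting into F(d_0 ⊗ id) and SF gives K + TKT, the summand SF contributing φ_1 =
Sφ_0. -/
theorem recursion_first (hF : F = F.susp.s0Right + F.susp.s0Right.twist + phi 0)
    {K : EMFam.{u} 1} (hK : K = F.susp.s0Right.susp + F.susp.s0Right.d0Right) :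
    EqFrom 2 (K + K.twist) (F.susp.s0Right.bdryComm + phi 1) := by
  intro i j m h hn
  obtain ⟨m, rfl⟩ : ∃ m', m = m' + 1 := ⟨m - 1, by omega⟩
  have hz : F.bdryComm.susp.s0Right i j (m + 1) h = 0 := by
    rcases i with _ | i
    · simp [s0Right]
    · simp [s0Right, bdryComm_eq_zero_of_split hF]
  have hL := congrFun (congrFun (congrFun (congrFun (congrArg d0Left hF) i) j) (m + 1)) h
  have hS := congrFun (congrFun (congrFun (congrFun (congrArg susp hF) i) j) (m + 1)) h
  rw [d0Left_add, d0Left_add, add_apply, add_apply, d0Left_phi_zero _ _ _ _ (by omega),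
    add_zero] at hL
  rw [susp_add, susp_add, add_apply, add_apply, susp_phi] at hS
  rw [hK, twist_add, twist_susp, twist_d0Right, add_apply, add_apply, add_apply, add_apply,
    bdryComm_susp_s0Right, hz, hL, hS]
  exact EMTrans.eq_of_add_eq_double (F.susp.s0Right.d0Left i j (m + 1) h +
    F.susp.s0Right.d0Right i j (m + 1) h + F.susp.s0Right.susp i j (m + 1) h +
    F.susp.s0Right.twist.d0Left i j (m + 1) h + F.susp.s0Right.twist.susp i j (m + 1) h +
    phi 1 i j (m + 1) h) (by abel)

theorem higherD_succ_of_even {k : ℕ} (hk : Even (k + 1)) :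
    higherD.{u} (k + 1) = (higherD k).susp + (higherD k).d0Left := by
  funext i j m h
  simp only [higherD, if_pos hk, add_apply]

theorem higherD_succ_of_not_even {k : ℕ} (hk : ¬ Even (k + 1)) :
    higherD.{u} (k + 1) = (higherD k).susp + (higherD k).d0Right := by
  funext i j m h
  simp only [higherD, if_neg hk, add_apply]

theorem isHigherEilenbergMacLane_higherD_of_split
    (hF : eilenbergMacLane.{u} = eilenbergMacLane.susp.s0Right +
      eilenbergMacLane.susp.s0Right.twist + phi 0) :
    IsHigherEilenbergMacLane higherD.{u} := by
  have hs : ∀ k, EqFrom (2 * (k + 1)) (higherD.{u} (k + 1) + (higherD (k + 1)).twist)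
      ((higherD k).bdryComm + phi (k + 1)) := by
    intro k
    induction k with
    | zero => exact recursion_first hF (higherD_succ_of_not_even (by decide))
    | succ k ih =>
      by_cases hk : Even (k + 1)
      · exact recursion_step (higherD_succ_of_even hk) (higherD_succ_of_not_even
          (by rw [Nat.even_add_one]; simpa using hk)) ih
      · exact recursion_step' (higherD_succ_of_not_even hk) (higherD_succ_of_even
          (by rw [Nat.even_add_one]; exact hk)) ih
  refine ⟨fun i j m h => ?_, fun k i j m h hij => hs k i j m h hij⟩
  have := congrFun (congrFun (congrFun (congrFun hF i) j) m) h
  have e : higherD.{u} 0 = eilenbergMacLane.susp.s0Right := rfl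
  rw [this, add_apply, add_apply, e]
  exact EMTrans.eq_of_add_eq_double (eilenbergMacLane.susp.s0Right i j m h +
    eilenbergMacLane.susp.s0Right.twist i j m h + phi 0 i j m h) (by abel)

end EMFam

/-! ### Collapsing operators -/

theorem SimplexCategory.hom_ext_val {m n : ℕ} {f g : SimplexCategory.mk m ⟶ SimplexCategory.mk n}
    (h : ∀ x : Fin (m + 1), (f.toOrderHom x : ℕ) = (g.toOrderHom x : ℕ)) : f = g := by
  ext x : 3
  exact Fin.ext (h x)

/-- The number of elements of a finite set below a given bound. -/
def countBelow (s : Finset ℕ) (x : ℕ) : ℕ := (s.filter (· < x)).card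

@[simp] theorem countBelow_zero (s : Finset ℕ) : countBelow s 0 = 0 := by
  simp [countBelow]

theorem countBelow_succ (s : Finset ℕ) (x : ℕ) :
    countBelow s (x + 1) = countBelow s x + if x ∈ s then 1 else 0 := by
  unfold countBelow
  split_ifs with h
  · rw [← Finset.card_insert_of_notMem (a := x) (s := s.filter (· < x)) (by simp)]
    congr 1
    ext t
    simp only [Finset.mem_filter, Finset.mem_insert]
    grind
  · congr 1
    ext t
    simp only [Finset.mem_filter]
    grind

theorem countBelow_le (s : Finset ℕ) (x : ℕ) : countBelow s x ≤ x := by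
  induction x with
  | zero => simp
  | succ x ih => rw [countBelow_succ]; split_ifs <;> omega

theorem sub_countBelow_monotone (s : Finset ℕ) : Monotone fun x => x - countBelow s x := by
  refine monotone_nat_of_le_succ fun x => ?_
  have := countBelow_le s x
  simp only [countBelow_succ]
  split_ifs <;> omega

/-- The translateOne of a set of natural numbers by one. -/
def translateOne (s : Finset ℕ) : Finset ℕ := s.map (addRightEmbedding 1)

@[simp] theorem succ_mem_translate {s : Finset ℕ} {x : ℕ} : x + 1 ∈ translateOne s ↔ x ∈ s := by
  simp [translateOne]

@[simp] theorem zero_notMem_translate {s : Finset ℕ} : 0 ∉ translateOne s := by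
  simp [translateOne]

@[simp] theorem card_translate (s : Finset ℕ) : (translateOne s).card = s.card :=
  Finset.card_map _

/-- The inverse of the translation by one, forgetting zero. -/
def untranslateOne (s : Finset ℕ) : Finset ℕ := s.preimage (· + 1) (by simp)

@[simp] theorem mem_untranslate {s : Finset ℕ} {x : ℕ} : x ∈ untranslateOne s ↔ x + 1 ∈ s := by
  simp [untranslateOne]

theorem ext_zero_succ {s t : Finset ℕ} (h0 : 0 ∈ s ↔ 0 ∈ t) (h : ∀ x, x + 1 ∈ s ↔ x + 1 ∈ t) :
    s = t := by
  ext x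
  cases x with
  | zero => exact h0
  | succ x => exact h x

theorem translate_untranslate {s : Finset ℕ} (h : 0 ∉ s) : translateOne (untranslateOne s) = s :=
  ext_zero_succ (by simp [h]) (by simp)

theorem insert_translate_untranslate {s : Finset ℕ} (h : 0 ∈ s) :
    insert 0 (translateOne (untranslateOne s)) = s :=
  ext_zero_succ (by simp [h]) (by simp)

theorem untranslate_translate (s : Finset ℕ) : untranslateOne (translateOne s) = s := by
  ext; simp

theorem untranslate_insert_translate (s : Finset ℕ) :
    untranslateOne (insert 0 (translateOne s)) = s := by
  ext; simp

theorem countBelow_translate (s : Finset ℕ) (x : ℕ) :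
    countBelow (translateOne s) (x + 1) = countBelow s x := by
  induction x with
  | zero => simp [countBelow_succ]
  | succ x ih => rw [countBelow_succ, ih, countBelow_succ]; simp

theorem countBelow_insert_translate (s : Finset ℕ) (x : ℕ) :
    countBelow (insert 0 (translateOne s)) (x + 1) = countBelow s x + 1 := by
  induction x with
  | zero => simp [countBelow_succ]
  | succ x ih => rw [countBelow_succ, ih, countBelow_succ]; simp; omega

/-- The operator `[N] → [n]`, `x ↦ x - #{t ∈ s | t < x}`, identifying `t` and `t + 1` for all
`t ∈ s`. -/
def collapse (N n : ℕ) (s : Finset ℕ) : SimplexCategory.mk N ⟶ SimplexCategory.mk n :=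
  SimplexCategory.mkHom
    -- The truncation at n makes the operator total; it is inactive if s ⊆ {0, …, N - 1} has N - n
    -- elements (`collapse_apply_of_card`).
    { toFun := fun x => ⟨min n (x - countBelow s x), Nat.lt_succ_of_le (min_le_left _ _)⟩
      monotone' := fun _ _ h => by
        have := sub_countBelow_monotone s h
        simp only [Fin.mk_le_mk]
        exact min_le_min le_rfl this }

theorem collapse_apply {N n : ℕ} (s : Finset ℕ) (x : Fin (N + 1)) :
    ((collapse N n s).toOrderHom x : ℕ) = min n (x - countBelow s x) := rfl

theorem shiftSimplex_collapse (N n : ℕ) (s : Finset ℕ) :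
    shiftSimplex.map (collapse N n s) = collapse (N + 1) (n + 1) (translateOne s) := by
  refine SimplexCategory.hom_ext_val (m := N + 1) (n := n + 1) fun x => ?_
  induction x using Fin.cases with
  | zero =>
    rw [collapse_apply]
    simp
    rfl
  | succ x =>
    rw [collapse_apply]
    change min n ((x : ℕ) - countBelow s x) + 1 = _
    have := countBelow_le s x
    simp only [Fin.val_succ, countBelow_translate]
    omega

/-- With `shiftSimplex_collapse` this translates the recursion into sets: suspension shifts s by
one, and a further s_0 adjoins 0. -/
theorem shiftSimplex_collapse_comp_σ (N n : ℕ) (s : Finset ℕ) :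
    shiftSimplex.map (collapse N n s) ≫ SimplexCategory.σ 0 =
      collapse (N + 1) n (insert 0 (translateOne s)) := by
  refine SimplexCategory.hom_ext_val (m := N + 1) (n := n) fun x => ?_
  induction x using Fin.cases with
  | zero =>
    rw [collapse_apply]
    simp
    rfl
  | succ x =>
    rw [collapse_apply]
    change min n ((x : ℕ) - countBelow s x) = _
    have := countBelow_le s x
    simp only [Fin.val_succ, countBelow_insert_translate]
    omega

theorem σ_apply {n : ℕ} (t : Fin (n + 1)) (x : Fin (n + 2)) :
    ((SimplexCategory.σ t).toOrderHom x : ℕ) = if (x : ℕ) ≤ t then (x : ℕ) else x - 1 := by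
  change ((t.predAbove x : Fin (n + 1)) : ℕ) = _
  unfold Fin.predAbove
  split_ifs with h1 h2 h2
  · exact absurd h1 (by simp [Fin.lt_def]; omega)
  · simp
  · simp
  · exact absurd h1 (by simp [Fin.lt_def]; omega)

theorem degen_apply (n : ℕ) (ν : ℕ → ℕ) (i : ℕ) (hν : ∀ r s, r < s → s < i → ν r < ν s)
    (hle : ∀ r < i, ν r ≤ n + r) (x : Fin (n + i + 1)) :
    ((degen n ν i).toOrderHom x : ℕ) = x - ((Finset.range i).filter (ν · < x)).card := by
  induction i with
  | zero => simp [degen]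
  | succ i ih =>
    have hi := hle i (by omega)
    have hc : ((degen n ν (i + 1)).toOrderHom x : ℕ) = ((degen n ν i).toOrderHom
        ((SimplexCategory.σ (Fin.ofNat (n + i + 1) (ν i))).toOrderHom x) : ℕ) := rfl
    have hσ := σ_apply (Fin.ofNat (n + i + 1) (ν i)) x
    rw [Fin.val_ofNat, Nat.mod_eq_of_lt (by omega : ν i < n + i + 1)] at hσ
    rw [hc, ih (fun r s h h' => hν r s h (by omega)) (fun r h => hle r (by omega)), hσ,
      Finset.range_add_one, Finset.filter_insert]
    split_ifs with h1 h2 h2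
    · omega
    · rfl
    · rw [Finset.card_insert_of_notMem (by simp)]
      -- As ν_i < x and the sequence increases, all earlier values stay below x - 1, so no count is
      -- lost when σ lowers x by one.
      have e1 : (Finset.range i).filter (ν · < (x : ℕ) - 1) = Finset.range i :=
        Finset.filter_true_of_mem fun r hr => by
          have := hν r i (Finset.mem_range.mp hr) (by omega)
          omega
      have e2 : (Finset.range i).filter (ν · < (x : ℕ)) = Finset.range i :=
        Finset.filter_true_of_mem fun r hr => by
          have := hν r i (Finset.mem_range.mp hr) (by omega)
          omega
      rw [e1, e2, Finset.card_range]
      omega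
    · omega

theorem card_toFinset_setOf_mem (s : Finset ℕ) (hf : (Set.ofPred (· ∈ s)).Finite) :
    hf.toFinset.card = s.card := by
  congr 1
  ext
  simp

theorem enum_lt_enum {s : Finset ℕ} {a b : ℕ} (h : a < b) (hb : b < s.card) :
    enum s a < enum s b := by
  have hf : (Set.ofPred (· ∈ s)).Finite := s.finite_toSet
  exact Nat.nth_lt_nth_of_lt_card hf h (by rwa [card_toFinset_setOf_mem])

theorem enum_mem {s : Finset ℕ} {a : ℕ} (ha : a < s.card) : enum s a ∈ s := by
  have hf : (Set.ofPred (· ∈ s)).Finite := s.finite_toSet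
  exact Nat.nth_mem_of_lt_card hf (by rwa [card_toFinset_setOf_mem])

theorem image_enum (s : Finset ℕ) : (Finset.range s.card).image (enum s) = s := by
  refine Finset.eq_of_subset_of_card_le ?_ ?_
  · intro x hx
    obtain ⟨a, ha, rfl⟩ := Finset.mem_image.mp hx
    exact enum_mem (Finset.mem_range.mp ha)
  · rw [Finset.card_image_of_injOn, Finset.card_range]
    intro a ha b hb hab
    rcases lt_trichotomy a b with h | h | h
    · exact absurd hab (enum_lt_enum h (by simpa using hb)).ne
    · exact h
    · exact absurd hab (enum_lt_enum h (by simpa using ha)).ne'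

/-- Descending induction from the largest element. It bounds the index of each degeneracy, so that
the reduction in `Fin.ofNat` in `degen` never takes effect. -/
theorem enum_add_le {s : Finset ℕ} {N a : ℕ} (hs : s ⊆ Finset.range N) (ha : a < s.card) :
    enum s a + s.card ≤ N + a := by
  obtain ⟨d, hd⟩ : ∃ d, s.card = a + 1 + d := ⟨s.card - (a + 1), by omega⟩
  induction d generalizing a with
  | zero =>
    have := Finset.mem_range.mp (hs (enum_mem ha))
    omega
  | succ d ih =>
    have h1 := ih (a := a + 1) (by omega) (by omega)
    have h2 := enum_lt_enum (s := s) (show a < a + 1 by omega) (by omega)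
    omega

theorem degen_enum {n i N : ℕ} {s : Finset ℕ} (hN : N = n + i) (hs : s ⊆ Finset.range N)
    (hi : s.card = i) : castOp hN ≫ degen n (enum s) i = collapse N n s := by
  subst hi hN
  refine SimplexCategory.hom_ext_val fun x => ?_
  have h := degen_apply n (enum s) s.card (fun r t h h' => enum_lt_enum h h')
    (fun r hr => by have := enum_add_le hs hr; omega) x
  have hc : ((Finset.range s.card).filter (enum s · < x)).card = countBelow s x := by
    have e : countBelow s x = (((Finset.range s.card).image (enum s)).filter (· < (x : ℕ))).card := by
      rw [image_enum, countBelow]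
    rw [e, Finset.filter_image, Finset.card_image_of_injOn]
    intro a ha b hb hab
    simp only [Finset.coe_filter, Finset.mem_range, Set.mem_ofPred_eq] at ha hb
    rcases lt_trichotomy a b with h | h | h
    · exact absurd hab (enum_lt_enum h hb.1).ne
    · exact h
    · exact absurd hab (enum_lt_enum h ha.1).ne'
  have hb := ((degen n (enum s) s.card).toOrderHom x).2
  rw [castOp_self, Category.id_comp, collapse_apply]
  rw [hc] at h
  change _ < n + 1 at hb
  rw [h] at hb ⊢
  omega

/-! ### Shuffles -/

theorem mem_shuffles {a i j : ℕ} {p : Finset ℕ × Finset ℕ} : p ∈ shuffles a i j ↔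
    p.1.card = i ∧ p.2.card = j ∧ Disjoint p.1 p.2 ∧ p.1 ∪ p.2 = Finset.Ico a (a + i + j) := by
  simp only [shuffles, Finset.mem_filter, Finset.mem_product, Finset.mem_powerset,
    and_iff_right_iff_imp]
  rintro ⟨-, -, -, h⟩
  rw [← h]
  exact ⟨Finset.subset_union_left, Finset.subset_union_right⟩

theorem mem_shuffles_iff {a i j : ℕ} {p : Finset ℕ × Finset ℕ} : p ∈ shuffles a i j ↔
    p.1.card = i ∧ p.2.card = j ∧ (∀ x ∈ p.1, x ∉ p.2) ∧
      ∀ x, (x ∈ p.1 ∨ x ∈ p.2) ↔ a ≤ x ∧ x < a + i + j := by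
  rw [mem_shuffles, Finset.disjoint_left, Finset.ext_iff]
  simp

theorem shuffles_subset_range {a i j : ℕ} {p : Finset ℕ × Finset ℕ} (hp : p ∈ shuffles a i j) :
    p.1 ⊆ Finset.range (a + i + j) ∧ p.2 ⊆ Finset.range (a + i + j) := by
  have h := (mem_shuffles_iff.mp hp).2.2.2
  exact ⟨fun x hx => Finset.mem_range.mpr ((h x).mp (.inl hx)).2,
    fun x hx => Finset.mem_range.mpr ((h x).mp (.inr hx)).2⟩

/-- The shuffles `(μ, ν)` with `μ_1 = a`. -/
def firstShuffles (a i j : ℕ) : Finset (Finset ℕ × Finset ℕ) := {p ∈ shuffles a i j | a ∈ p.1}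

/-- Removing 0 from μ and shifting down is a bijection; it is the index set side of S(D)(id ⊗ s_0).
-/
theorem sum_firstShuffles_zero (i j : ℕ) {M : Type*} [AddCommMonoid M]
    (f : Finset ℕ × Finset ℕ → M) : ∑ p ∈ firstShuffles 0 (i + 1) j, f p =
      ∑ p ∈ shuffles 0 i j, f (insert 0 (translateOne p.1), translateOne p.2) := by
  symm
  refine Finset.sum_nbij' (fun p => (insert 0 (translateOne p.1), translateOne p.2))
    (fun p => (untranslateOne p.1, untranslateOne p.2)) ?_ ?_ ?_ ?_ ?_
  · intro p hp
    rw [mem_shuffles_iff] at hp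
    obtain ⟨h1, h2, h3, h4⟩ := hp
    rw [firstShuffles, Finset.mem_filter, mem_shuffles_iff]
    refine ⟨⟨by simp [h1], by simp [h2], ?_, ?_⟩, by simp⟩
    · intro x
      cases x with
      | zero => simp
      | succ x => simpa using h3 x
    · intro x
      cases x with
      | zero => simp
      | succ x => have := h4 x; simp; simp at this; rw [this]; omega
  · intro p hp
    rw [firstShuffles, Finset.mem_filter, mem_shuffles_iff] at hp
    obtain ⟨⟨h1, h2, h3, h4⟩, h0⟩ := hp
    rw [mem_shuffles_iff]
    refine ⟨?_, ?_, fun x => ?_, fun x => ?_⟩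
    · rw [← insert_translate_untranslate h0] at h1
      simpa using h1
    · rw [← translate_untranslate (h3 0 h0)] at h2
      simpa using h2
    · simpa using h3 (x + 1)
    · have := h4 (x + 1)
      simp at this ⊢
      rw [this]
      omega
  · intro p _
    simp [untranslate_translate, untranslate_insert_translate]
  · intro p hp
    rw [firstShuffles, Finset.mem_filter, mem_shuffles_iff] at hp
    simp [insert_translate_untranslate hp.2, translate_untranslate (hp.1.2.2.1 0 hp.2)]
  · intro p _
    rfl

/-- The index set side of one suspension. -/
theorem sum_firstShuffles_succ (a i j : ℕ) {M : Type*} [AddCommMonoid M]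
    (f : Finset ℕ × Finset ℕ → M) : ∑ p ∈ firstShuffles (a + 1) i j, f p =
      ∑ p ∈ firstShuffles a i j, f (translateOne p.1, translateOne p.2) := by
  symm
  refine Finset.sum_nbij' (fun p => (translateOne p.1, translateOne p.2))
    (fun p => (untranslateOne p.1, untranslateOne p.2)) ?_ ?_ ?_ ?_ ?_
  · intro p hp
    rw [firstShuffles, Finset.mem_filter, mem_shuffles_iff] at hp
    obtain ⟨⟨h1, h2, h3, h4⟩, h0⟩ := hp
    rw [firstShuffles, Finset.mem_filter, mem_shuffles_iff]
    refine ⟨⟨by simp [h1], by simp [h2], ?_, ?_⟩, by simpa using h0⟩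
    · intro x
      cases x with
      | zero => simp
      | succ x => simpa using h3 x
    · intro x
      cases x with
      | zero => simp
      | succ x => have := h4 x; simp; rw [this]; omega
  · intro p hp
    rw [firstShuffles, Finset.mem_filter, mem_shuffles_iff] at hp
    obtain ⟨⟨h1, h2, h3, h4⟩, h0⟩ := hp
    have hz := h4 0
    simp only [nonpos_iff_eq_zero, Nat.add_eq_zero_iff, one_ne_zero, and_false, false_and,
      iff_false, not_or] at hz
    rw [firstShuffles, Finset.mem_filter, mem_shuffles_iff]
    refine ⟨⟨?_, ?_, fun x => ?_, fun x => ?_⟩, by simpa using h0⟩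
    · rw [← translate_untranslate hz.1] at h1
      simpa using h1
    · rw [← translate_untranslate hz.2] at h2
      simpa using h2
    · simpa using h3 (x + 1)
    · have := h4 (x + 1)
      simp at this ⊢
      rw [this]
      omega
  · intro p _
    simp [untranslate_translate]
  · intro p hp
    rw [firstShuffles, Finset.mem_filter, mem_shuffles_iff] at hp
    have hz := hp.1.2.2.2 0
    simp only [nonpos_iff_eq_zero, Nat.add_eq_zero_iff, one_ne_zero, and_false, false_and,
      iff_false, not_or] at hz
    simp [translate_untranslate hz.1, translate_untranslate hz.2]
  · intro p _
    rfl

/-! ### The Eilenberg–MacLane map in terms of collapsing operators, and its splitting. -/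

namespace EMFam

theorem eilenbergMacLane_eq (i j m : ℕ) (h : m + 0 = i + j) : eilenbergMacLane.{u} i j m h =
    ∑ p ∈ shuffles 0 i j, EMTrans.ofOps (collapse m i p.2) (collapse m j p.1) := by
  refine Finset.sum_congr rfl fun p hp => ?_
  have hr := shuffles_subset_range hp
  have hc := mem_shuffles.mp hp
  rw [show 0 + i + j = m by omega] at hr
  rw [degen_enum (by omega) hr.2 hc.2.1, degen_enum (by omega) hr.1 hc.1]

theorem higherD_zero_eq (i j m : ℕ) (h : m + 0 = i + j) : higherD.{u} 0 i j m h =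
    ∑ p ∈ firstShuffles 0 i j, EMTrans.ofOps (collapse m i p.2) (collapse m j p.1) := by
  change eilenbergMacLane.susp.s0Right i j m h = _
  rcases i with _ | i
  · rw [Finset.sum_eq_zero]
    · simp [s0Right]
    · intro p hp
      rw [firstShuffles, Finset.mem_filter, mem_shuffles, Finset.card_eq_zero] at hp
      rw [hp.1.1] at hp
      simp at hp
  · obtain ⟨m, rfl⟩ : ∃ m', m = m' + 1 := ⟨m - 1, by omega⟩
    rw [sum_firstShuffles_zero, s0Right, susp_succ, eilenbergMacLane_eq, EMTrans.susp_sum,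
      EMTrans.sum_comp]
    refine Finset.sum_congr rfl fun p _ => ?_
    rw [EMTrans.susp_ofOps, ← shiftSimplex_collapse_comp_σ m j p.1,
      ← shiftSimplex_collapse m i p.2]
    refine (EMTrans.ofOps_comp _ _ _ _).trans ?_
    congr 1

theorem collapse_empty (n : ℕ) : collapse n n ∅ = 𝟙 _ := by
  refine SimplexCategory.hom_ext_val fun x => ?_
  simp [collapse_apply, countBelow]
  omega

/-- In positive total degree 0 lies in exactly one of μ and ν, and exchanging the two sets is
conjugation by T. In degree (0,0) only the empty shuffle remains, and it gives φ_0. -/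
theorem eilenbergMacLane_split : eilenbergMacLane.{u} =
    eilenbergMacLane.susp.s0Right + eilenbergMacLane.susp.s0Right.twist + phi 0 := by
  change eilenbergMacLane.{u} = higherD 0 + (higherD 0).twist + phi 0
  funext i j m h
  rw [add_apply, add_apply, twist, higherD_zero_eq, higherD_zero_eq, eilenbergMacLane_eq,
    EMTrans.twist_sum]
  simp only [EMTrans.twist_ofOps]
  have hsw : ∑ p ∈ firstShuffles 0 j i, EMTrans.ofOps.{u} (collapse m i p.1) (collapse m j p.2) =
      ∑ p ∈ shuffles 0 i j with 0 ∈ p.2, EMTrans.ofOps (collapse m i p.2) (collapse m j p.1) := by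
    refine Finset.sum_nbij' Prod.swap Prod.swap ?_ ?_ ?_ ?_ ?_
    · intro p hp
      simp only [firstShuffles, Finset.mem_filter, mem_shuffles_iff, Prod.fst_swap,
        Prod.snd_swap] at hp ⊢
      refine ⟨⟨hp.1.2.1, hp.1.1, fun x hx hx' => hp.1.2.2.1 x hx' hx, fun x => ?_⟩, hp.2⟩
      rw [or_comm, hp.1.2.2.2]
      omega
    · intro p hp
      simp only [firstShuffles, Finset.mem_filter, mem_shuffles_iff, Prod.fst_swap,
        Prod.snd_swap] at hp ⊢
      refine ⟨⟨hp.1.2.1, hp.1.1, fun x hx hx' => hp.1.2.2.1 x hx' hx, fun x => ?_⟩, hp.2⟩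
      rw [or_comm, hp.1.2.2.2]
      omega
    · simp
    · simp
    · simp
  rw [hsw]
  by_cases hij : i + j = 0
  · obtain rfl : i = 0 := by omega
    obtain rfl : j = 0 := by omega
    obtain rfl : m = 0 := by omega
    have : shuffles 0 0 0 = {(∅, ∅)} := by decide
    simp [firstShuffles, this, phi, Finset.filter_singleton, collapse_empty]
  · rw [phi_eq_zero _ _ _ _ (by omega), add_zero, firstShuffles,
      ← Finset.sum_filter_add_sum_filter_not (shuffles 0 i j) (fun p => 0 ∈ p.1)]
    congr 1
    refine Finset.sum_congr (Finset.filter_congr fun p hp => ?_) fun _ _ => rfl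
    have hp := mem_shuffles_iff.mp hp
    have h0 := hp.2.2.2 0
    have h1 := hp.2.2.1 0
    have : 0 ∈ p.1 ∨ 0 ∈ p.2 := h0.mpr ⟨le_rfl, by omega⟩
    tauto

theorem isHigherEilenbergMacLane_higherD : IsHigherEilenbergMacLane higherD.{u} :=
  isHigherEilenbergMacLane_higherD_of_split eilenbergMacLane_split

theorem bdryComm_eilenbergMacLane (i j m : ℕ) (h : m + 1 = i + j) :
    eilenbergMacLane.{u}.bdryComm i j m h = 0 :=
  bdryComm_eq_zero_of_split eilenbergMacLane_split i j m h

end EMFam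

/-! ### Normalized elements -/

/-- An element killed by all non-surjective operators. -/
def SVect.IsNormalized (V : SVect.{u}) {n : ℕ} (x : V.deg n) : Prop :=
  ∀ (l : ℕ) (a : SimplexCategory.mk l ⟶ SimplexCategory.mk n),
    ¬ Function.Surjective a.toOrderHom → V.act a x = 0

theorem SimplexCategory.δ_not_surjective {n : ℕ} (r : Fin (n + 2)) :
    ¬ Function.Surjective (SimplexCategory.δ r).toOrderHom := fun h => by
  obtain ⟨x, hx⟩ := h r
  exact Fin.succAbove_ne r x hx

/-- A non-surjective operator factors through a face. In this form the condition passes to the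
shifted object and can be tested on composites with collapsing operators. -/
theorem SVect.mem_normCycles_iff (V : SVect.{u}) {n : ℕ} (x : V.deg n) :
    x ∈ V.normCycles n ↔ V.IsNormalized x := by
  cases n with
  | zero =>
    refine ⟨fun _ l a ha => absurd (fun y => ⟨0, Subsingleton.elim (α := Fin 1) _ _⟩) ha,
      fun _ => trivial⟩
  | succ n =>
    simp only [SVect.normCycles, Submodule.mem_iInf, LinearMap.mem_ker]
    constructor
    · intro h l a ha
      obtain ⟨r, b, rfl⟩ := SimplexCategory.eq_comp_δ_of_not_surjective a ha
      have e : V.act (b ≫ SimplexCategory.δ r) x =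
          (V.map b.op).hom ((V.map (SimplexCategory.δ r).op).hom x) := by
        simp [SVect.act]
      rw [e]
      exact (congrArg _ (h r)).trans (map_zero _)
    · intro h r
      exact h n (SimplexCategory.δ r) (SimplexCategory.δ_not_surjective r)

theorem SVect.IsNormalized.shift {V : SVect.{u}} {n : ℕ} {x : V.deg (n + 1)}
    (hx : V.IsNormalized x) : V.shift.IsNormalized (n := n) x := by
  intro l a ha
  refine hx (l + 1) (shiftSimplex.map a) fun h => ha fun y => ?_
  obtain ⟨t, ht⟩ := h y.succ
  induction t using Fin.cases with
  | zero => exact absurd ht (Fin.succ_ne_zero y).symm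
  | succ t => exact ⟨t, Fin.succ_injective _ ht⟩

theorem SVect.IsNormalized.act_δ {V : SVect.{u}} {n : ℕ} {x : V.deg (n + 1)}
    (hx : V.IsNormalized x) (r : Fin (n + 2)) : V.act (SimplexCategory.δ r) x = 0 :=
  hx n _ (SimplexCategory.δ_not_surjective r)

/-- The d_0 terms of the recursion vanish on normalized elements, which remain normalized in the
shifted objects. Only the k-fold suspension of D^0 is left. -/
theorem EMFam.higherD_app_tmul (k : ℕ) {n₁ n₂ N : ℕ} (h : N + k = n₁ + n₂) (h₁ : k ≤ n₁)
    (h₂ : k ≤ n₂) (V W : SVect.{u}) {x : V.deg n₁} {y : W.deg n₂} (hx : V.IsNormalized x)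
    (hy : W.IsNormalized y) :
    (higherD k n₁ n₂ N h).app V W (x ⊗ₜ y) = ∑ p ∈ firstShuffles k (n₁ - k) (n₂ - k),
      V.act (collapse N n₁ p.2) x ⊗ₜ W.act (collapse N n₂ p.1) y := by
  induction k generalizing n₁ n₂ N V W with
  | zero =>
    rw [higherD_zero_eq, EMTrans.sum_app, LinearMap.sum_apply]
    rfl
  | succ k ih =>
    obtain ⟨n₁, rfl⟩ : ∃ n, n₁ = n + 1 := ⟨n₁ - 1, by omega⟩
    obtain ⟨n₂, rfl⟩ : ∃ n, n₂ = n + 1 := ⟨n₂ - 1, by omega⟩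
    obtain ⟨N, rfl⟩ : ∃ n, N = n + 1 := ⟨N - 1, by omega⟩
    have e : (higherD.{u} (k + 1) (n₁ + 1) (n₂ + 1) (N + 1) h).app V W (x ⊗ₜ y) =
        (higherD k n₁ n₂ N (by omega)).app V.shift W.shift (x ⊗ₜ y) := by
      simp only [higherD]
      rw [EMTrans.add_app, LinearMap.add_apply]
      refine add_eq_left.mpr ?_
      split_ifs
      · change ((higherD k n₁ (n₂ + 1) (N + 1) (by omega)).app V W)
          ((V.act (SimplexCategory.δ 0) x) ⊗ₜ (W.act (𝟙 _) y)) = 0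
        rw [hx.act_δ, TensorProduct.zero_tmul, map_zero]
      · change ((higherD k (n₁ + 1) n₂ (N + 1) (by omega)).app V W)
          ((V.act (𝟙 _) x) ⊗ₜ (W.act (SimplexCategory.δ 0) y)) = 0
        rw [hy.act_δ, TensorProduct.tmul_zero, map_zero]
    rw [e, ih (by omega) (by omega) (by omega) V.shift W.shift hx.shift hy.shift,
      sum_firstShuffles_succ, Nat.add_sub_add_right, Nat.add_sub_add_right]
    refine Finset.sum_congr rfl fun p _ => ?_
    rw [← shiftSimplex_collapse N n₁, ← shiftSimplex_collapse N n₂]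
    rfl

/-! ### The explicit formula -/

/-- As q - i is the least element of the union, it is μ_1 as soon as it belongs to μ. -/
theorem setV_eq {q i : ℕ} (hi : 1 ≤ i) : setV q i = firstShuffles (q - i) i i := by
  refine Finset.filter_congr fun p hp => ?_
  have hp := mem_shuffles_iff.mp hp
  constructor
  · intro h
    rw [← h]
    exact enum_mem (by omega)
  · intro h
    rw [← image_enum p.1] at h
    obtain ⟨a, ha, hae⟩ := Finset.mem_image.mp h
    have h0 := ((hp.2.2.2 _).mp (.inl (enum_mem (s := p.1) (a := 0) (by omega)))).1
    rcases Nat.eq_zero_or_pos a with rfl | h'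
    · exact hae
    · have := enum_lt_enum h' (Finset.mem_range.mp ha)
      omega

theorem delta_eq (R : SAlg.{u}) {q i : ℕ} (hi : 1 ≤ i) (hiq : i ≤ q) (z : R.deg q) :
    delta R q i z = ∑ p ∈ firstShuffles (q - i) i i,
      (R.map (collapse (q + i) q p.2).op).hom z * (R.map (collapse (q + i) q p.1).op).hom z := by
  rw [delta, setV_eq hi]
  refine Finset.sum_congr rfl fun p hp => ?_
  have hp := (Finset.mem_filter.mp hp).1
  have hr := shuffles_subset_range hp
  have hc := mem_shuffles.mp hp
  rw [show q - i + i + i = q + i by omega] at hr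
  rw [← degen_enum rfl hr.2 hc.2.1, ← degen_enum rfl hr.1 hc.1, castOp_self, Category.id_comp,
    Category.id_comp]

theorem delta_eq_higherD (R : SAlg.{u}) {q i : ℕ} (hi : 1 ≤ i) (hiq : i ≤ q)
    (h : q + i + (q - i) = q + q) {z : R.toVect.deg q} (hz : z ∈ R.toVect.normCycles q) :
    delta R q i z = R.mulMap (q + i)
      ((EMFam.higherD (q - i) q q (q + i) h).app R.toVect R.toVect (z ⊗ₜ[ZMod 2] z)) := by
  have hz := (R.toVect.mem_normCycles_iff z).mp hz
  rw [EMFam.higherD_app_tmul _ h (by omega) (by omega) _ _ hz hz, delta_eq R hi hiq, map_sum,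
    Nat.sub_sub_self hiq]
  refine Finset.sum_congr rfl fun p _ => ?_
  exact (LinearMap.mul'_apply).symm

theorem collapse_apply_of_card {N n : ℕ} {s : Finset ℕ} (hs : s ⊆ Finset.range N)
    (hn : n + s.card = N) (x : Fin (N + 1)) :
    ((collapse N n s).toOrderHom x : ℕ) = x - countBelow s x := by
  have h1 : (x : ℕ) - countBelow s x ≤ N - countBelow s N :=
    sub_countBelow_monotone s (Nat.lt_succ_iff.mp x.2)
  have h2 : countBelow s N = s.card := by
    rw [countBelow, Finset.filter_true_of_mem fun t ht => Finset.mem_range.mp (hs ht)]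
  rw [collapse_apply]
  omega

/-- If an operator missing `r` remains surjective after collapsing along `s`, then `s` contains
`r - 1` or `r`. -/
theorem mem_or_mem_of_surjective {l N n r : ℕ} {s : Finset ℕ} (hs : s ⊆ Finset.range N)
    (hn : n + s.card = N) (a : SimplexCategory.mk l ⟶ SimplexCategory.mk N) (hrN : r < N + 1)
    (hr : ∀ x : Fin (l + 1), (a.toOrderHom x : ℕ) ≠ r)
    (h : Function.Surjective (a ≫ collapse N n s).toOrderHom) : r - 1 ∈ s ∨ r ∈ s := by
  by_contra hcon
  rw [not_or] at hcon
  obtain ⟨x, hx⟩ := h ((collapse N n s).toOrderHom ⟨r, hrN⟩)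
  have hx' := congrArg Fin.val hx
  change ((collapse N n s).toOrderHom (a.toOrderHom x) : ℕ) = _ at hx'
  rw [collapse_apply_of_card hs hn, collapse_apply_of_card hs hn] at hx'
  have hxr := hr x
  generalize ((a.toOrderHom x : Fin (N + 1)) : ℕ) = t at hx' hxr
  change t - countBelow s t = r - countBelow s r at hx'
  have hmono := sub_countBelow_monotone s
  have hle := countBelow_le s
  -- If r - 1 and r are not in s, the collapse increases strictly just before and just after r, so
  -- its value at r is taken nowhere else.
  rcases lt_or_gt_of_ne hxr with hlt | hgt
  · have h1 : t - countBelow s t ≤ (r - 1) - countBelow s (r - 1) := hmono (by omega)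
    have h2 := countBelow_succ s (r - 1)
    rw [Nat.sub_add_cancel (by omega), if_neg hcon.1] at h2
    have := hle (r - 1)
    omega
  · have h1 : (r + 1) - countBelow s (r + 1) ≤ t - countBelow s t := hmono hgt
    have h2 := countBelow_succ s r
    rw [if_neg hcon.2] at h2
    have := hle r
    omega

/-- The exchange of `r - 1` and `r` in a set of natural numbers. -/
def exchange (r : ℕ) (s : Finset ℕ) : Finset ℕ := s.map (Equiv.swap (r - 1) r).toEmbedding

theorem mem_exchange {r x : ℕ} {s : Finset ℕ} : x ∈ exchange r s ↔ Equiv.swap (r - 1) r x ∈ s := by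
  rw [exchange, Finset.mem_map_equiv, Equiv.symm_swap]

@[simp] theorem card_exchange (r : ℕ) (s : Finset ℕ) : (exchange r s).card = s.card :=
  Finset.card_map _

@[simp] theorem exchange_exchange (r : ℕ) (s : Finset ℕ) : exchange r (exchange r s) = s := by
  ext
  simp [mem_exchange]

/-- Only the threshold x = r separates r - 1 from r; an operator missing r therefore cannot see the
exchange. -/
theorem countBelow_exchange {r x : ℕ} (s : Finset ℕ) (hx : x ≠ r) :
    countBelow (exchange r s) x = countBelow s x := by
  rw [countBelow, countBelow, exchange, Finset.filter_map, Finset.card_map]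
  congr 1
  refine Finset.filter_congr fun t _ => ?_
  simp only [Function.comp_apply, Equiv.coe_toEmbedding, Equiv.swap_apply_def]
  split_ifs <;> omega

theorem comp_collapse_exchange {l N n r : ℕ} (s : Finset ℕ)
    (a : SimplexCategory.mk l ⟶ SimplexCategory.mk N)
    (hr : ∀ x : Fin (l + 1), (a.toOrderHom x : ℕ) ≠ r) :
    a ≫ collapse N n (exchange r s) = a ≫ collapse N n s := by
  refine SimplexCategory.hom_ext_val fun x => ?_
  change ((collapse N n (exchange r s)).toOrderHom (a.toOrderHom x) : ℕ) =
    ((collapse N n s).toOrderHom (a.toOrderHom x) : ℕ)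
  rw [collapse_apply, collapse_apply, countBelow_exchange s (hr x)]

theorem exchange_mem_shuffles {r b i j : ℕ} {p : Finset ℕ × Finset ℕ} (hp : p ∈ shuffles b i j)
    (h1 : r - 1 ∈ p.1 ∨ r - 1 ∈ p.2) (h2 : r ∈ p.1 ∨ r ∈ p.2) :
    (exchange r p.1, exchange r p.2) ∈ shuffles b i j := by
  rw [mem_shuffles_iff] at hp ⊢
  obtain ⟨hp1, hp2, hp3, hp4⟩ := hp
  refine ⟨by simpa, by simpa, fun x hx => ?_, fun x => ?_⟩
  · rw [mem_exchange] at hx ⊢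
    exact hp3 _ hx
  · rw [mem_exchange, mem_exchange, hp4]
    rw [hp4] at h1 h2
    rw [Equiv.swap_apply_def]
    split_ifs <;> omega

theorem swap_mem_shuffles {b i : ℕ} {p : Finset ℕ × Finset ℕ} (hp : p ∈ shuffles b i i) :
    p.swap ∈ shuffles b i i := by
  rw [mem_shuffles_iff] at hp ⊢
  exact ⟨hp.2.1, hp.1, fun x h h' => hp.2.2.1 x h' h, fun x => by
    rw [← hp.2.2.2 x]; exact or_comm⟩

/-- The involution under which the terms of a face of the explicit formula cancel. -/
def cancelPartner (b r : ℕ) (p : Finset ℕ × Finset ℕ) : Finset ℕ × Finset ℕ :=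
  if r - 1 = b then (exchange r p.2, exchange r p.1) else (exchange r p.1, exchange r p.2)

theorem cancelPartner_cancelPartner (b r : ℕ) (p : Finset ℕ × Finset ℕ) :
    cancelPartner b r (cancelPartner b r p) = p := by
  unfold cancelPartner
  split_ifs <;> simp

/-- Let a miss r. A term survives a only if each of μ, ν contains one of r - 1, r. Exchanging these
two numbers leaves both factors unchanged, so terms cancel in pairs. If r - 1 = q - i, the exchange
moves the least element out of μ; swapping μ and ν restores it, and the product is unchanged by
commutativity. -/
theorem delta_mem_normCycles (R : SAlg.{u}) {q i : ℕ} (hi : 2 ≤ i) (hiq : i ≤ q)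
    {z : R.toVect.deg q} (hz : z ∈ R.toVect.normCycles q) :
    delta R q i z ∈ R.toVect.normCycles (q + i) := by
  rw [R.toVect.mem_normCycles_iff] at hz
  refine (R.toVect.mem_normCycles_iff _).mpr fun l a ha => ?_
  rw [delta_eq R (by omega) hiq]
  change (R.map a.op).hom _ = 0
  obtain ⟨⟨r, hrN⟩, hr⟩ := not_forall.mp ha
  change r < q + i + 1 at hrN
  replace hr : ∀ x : Fin (l + 1), (a.toOrderHom x : ℕ) ≠ r :=
    fun x hx => hr ⟨x, Fin.ext hx⟩
  rw [map_sum]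
  set b := q - i with hb
  let t (s : Finset ℕ) : R.deg l := (R.map (a ≫ collapse (q + i) q s).op).hom z
  have ht : ∀ s, (R.map a.op).hom ((R.map (collapse (q + i) q s).op).hom z) = t s := by
    intro s
    simp [t]
  have ht0 : ∀ p ∈ shuffles b i i, ∀ s, s = p.1 ∨ s = p.2 → t s ≠ 0 → r - 1 ∈ s ∨ r ∈ s := by
    intro p hp s hs h0
    have hr' := shuffles_subset_range hp
    have hc := mem_shuffles.mp hp
    rw [show b + i + i = q + i by omega] at hr'
    by_contra hcon
    refine h0 (hz l _ fun hsur => hcon ?_)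
    rcases hs with rfl | rfl
    · exact mem_or_mem_of_surjective hr'.1 (by omega) a hrN hr hsur
    · exact mem_or_mem_of_surjective hr'.2 (by omega) a hrN hr hsur
  have hte : ∀ s, t (exchange r s) = t s := by
    intro s
    simp only [t, comp_collapse_exchange s a hr]
  simp only [map_mul, ht]
  -- For r = 0 the truncated difference r - 1 is again 0, and disjointness of μ and ν leaves no
  -- terms at all.
  rw [← Finset.sum_filter_of_ne (p := fun p : Finset ℕ × Finset ℕ =>
    (r - 1 ∈ p.1 ∧ r ∈ p.2) ∨ (r ∈ p.1 ∧ r - 1 ∈ p.2))]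
  swap
  · intro p hp hne
    have hps := (Finset.mem_filter.mp hp).1
    have h1 := ht0 p hps p.1 (.inl rfl) (right_ne_zero_of_mul hne)
    have h2 := ht0 p hps p.2 (.inr rfl) (left_ne_zero_of_mul hne)
    have h3 := (mem_shuffles_iff.mp hps).2.2.1
    have := h3 r
    have := h3 (r - 1)
    tauto
  refine Finset.sum_involution (fun p _ => cancelPartner b r p) ?_ ?_ ?_ ?_
  · intro p _
    have h2 : ∀ x : R.deg l, x + x = 0 := fun x => ZModModule.add_self (G := R.toVect.deg l) x
    unfold cancelPartner
    split_ifs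
    · simp only [hte]
      rw [mul_comm (t p.1), h2]
    · simp only [hte, h2]
  · intro p hp _ he
    rw [Finset.mem_filter, firstShuffles, Finset.mem_filter] at hp
    obtain ⟨⟨hps, hbp⟩, hrp⟩ := hp
    obtain ⟨hp1, hp2, hp3, hp4⟩ := mem_shuffles_iff.mp hps
    unfold cancelPartner at he
    split_ifs at he with hrb
    -- This is where i ≥ 2 enters: r + 1 = q - i + 2 still lies in the union and is not moved by the
    -- exchange, so swapping μ and ν cannot fix the pair.
    · have hm := (hp4 (r + 1)).mpr (by
        have : r ≠ 0 := by
          rintro rfl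
          have := hp3 0
          simp at hrp
          tauto
        omega)
      have hsw : Equiv.swap (r - 1) r (r + 1) = r + 1 :=
        Equiv.swap_apply_of_ne_of_ne (by omega) (by omega)
      have h1 : r + 1 ∈ p.2 ↔ r + 1 ∈ p.1 := by
        conv_rhs => rw [← he]
        rw [mem_exchange, hsw]
      have := hp3 (r + 1)
      tauto
    · have h1 : r ∈ p.1 ↔ r - 1 ∈ p.1 := by
        conv_lhs => rw [← he]
        rw [mem_exchange, Equiv.swap_apply_right]
      have := hp3 r
      have := hp3 (r - 1)
      tauto
  · intro p hp
    rw [Finset.mem_filter, firstShuffles, Finset.mem_filter] at hp ⊢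
    obtain ⟨⟨hps, hbp⟩, hrp⟩ := hp
    obtain ⟨hp1, hp2, hp3, hp4⟩ := mem_shuffles_iff.mp hps
    have hps' := exchange_mem_shuffles (r := r) hps (by tauto) (by tauto)
    have hlow := (hp4 (r - 1)).mp (by tauto)
    unfold cancelPartner
    split_ifs with hrb
    · have hnb := hp3 _ hbp
      have h1 : r - 1 ∈ p.1 ∧ r ∈ p.2 := by
        rw [hrb] at hrp ⊢
        tauto
      refine ⟨⟨swap_mem_shuffles hps', ?_⟩, .inl ⟨?_, ?_⟩⟩
      · simp only [mem_exchange, ← hrb, Equiv.swap_apply_left]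
        exact h1.2
      · simp only [mem_exchange, Equiv.swap_apply_left]
        exact h1.2
      · simp only [mem_exchange, Equiv.swap_apply_right]
        exact h1.1
    -- Here r - 1 lies strictly above b, so the exchange does not touch b.
    · refine ⟨⟨hps', ?_⟩, ?_⟩
      · simp only [mem_exchange]
        rwa [Equiv.swap_apply_of_ne_of_ne (by omega)]
        rintro rfl
        have : b ≠ b - 1 := fun e => hrb e.symm
        omega
      · simp only [mem_exchange, Equiv.swap_apply_left, Equiv.swap_apply_right]
        tauto
  · intro p _
    exact cancelPartner_cancelPartner b r p

/-! ### Normalization of cycles -/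

open AlgebraicTopology AlgebraicTopology.DoldKan in
-- Signs are invisible modulo two, so the Dold–Kan projection and its homotopy to the identity apply
-- to the unsigned complex.
theorem SVect.alternatingFaceMap_d (V : SVect.{u}) (n : ℕ) :
    ((AlternatingFaceMapComplex.obj V).d (n + 1) n).hom = V.bdrySucc n := by
  have hs : ∀ (r : ℕ) (f : V.deg (n + 1) →ₗ[ZMod 2] V.deg n), (-1 : ℤ) ^ r • f = f := by
    intro r f
    rcases neg_one_pow_eq_or ℤ r with h | h
    · rw [h, one_smul]
    · rw [h, neg_smul, one_smul]
      ext x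
      exact ZModModule.neg_eq_self _
  rw [AlternatingFaceMapComplex.obj_d_eq, SVect.bdrySucc, ModuleCat.hom_sum]
  exact Finset.sum_congr rfl fun r _ => hs r _

open AlgebraicTopology AlgebraicTopology.DoldKan in
theorem SVect.bdrySucc_bdrySucc (V : SVect.{u}) (n : ℕ) (x : V.deg (n + 2)) :
    V.bdrySucc n (V.bdrySucc (n + 1) x) = 0 := by
  have h := (AlternatingFaceMapComplex.obj V).d_comp_d (n + 2) (n + 1) n
  have h' := congrArg (fun f => f.hom x) h
  rw [← V.alternatingFaceMap_d, ← V.alternatingFaceMap_d]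
  exact h'

open AlgebraicTopology AlgebraicTopology.DoldKan in
/-- The projection of `V_n` onto the normalized chains. -/
def SVect.normalize (V : SVect.{u}) (n : ℕ) : V.deg n →ₗ[ZMod 2] V.deg n :=
  ((PInfty : AlternatingFaceMapComplex.obj V ⟶ _).f n).hom

open AlgebraicTopology AlgebraicTopology.DoldKan in
theorem SVect.exists_normalize_eq (V : SVect.{u}) (n : ℕ) {x : V.deg n} (hx : x ∈ V.cycles n) :
    ∃ u, V.normalize n x = x + V.bdrySucc n u := by
  have h := congrArg (fun f => f.hom x) ((homotopyPInftyToId V).comm n)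
  refine ⟨((homotopyPInftyToId V).hom n (n + 1)).hom x, h.trans ?_⟩
  rw [Homotopy.prevD_chainComplex, ← V.alternatingFaceMap_d]
  have hd : (dNext n (homotopyPInftyToId V).hom).hom x = 0 := by
    cases n with
    | zero => rw [Homotopy.dNext_zero_chainComplex]; rfl
    | succ n =>
      rw [Homotopy.dNext_succ_chainComplex]
      have hx' : ((AlternatingFaceMapComplex.obj V).d (n + 1) n).hom x = 0 := by
        rw [V.alternatingFaceMap_d]; exact hx
      exact (congrArg ((homotopyPInftyToId V).hom n (n + 1)).hom hx').trans
        (map_zero ((homotopyPInftyToId V).hom n (n + 1)).hom)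
  refine (congrArg (fun t : V.deg n => t + _ + x) hd).trans ?_
  exact (congrArg (fun t : V.deg n => t + x) (zero_add _)).trans (add_comm _ _)

theorem SVect.bdry_mem_cycles (V : SVect.{u}) (n : ℕ) (x : V.deg (n + 1)) :
    V.bdrySucc n x ∈ V.cycles n := by
  cases n with
  | zero => rfl
  | succ n => exact V.bdrySucc_bdrySucc n x

open AlgebraicTopology AlgebraicTopology.DoldKan in
/-- Every cycle is homologous to a normalized cycle. -/
theorem SVect.exists_normCycle (V : SVect.{u}) (n : ℕ) {x : V.deg n} (hx : x ∈ V.cycles n) :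
    ∃ z ∈ V.normCycles n, ∃ u, z = x + V.bdrySucc n u := by
  obtain ⟨u, hu⟩ := V.exists_normalize_eq n hx
  refine ⟨_, ?_, u, rfl⟩
  have hc : x + V.bdrySucc n u ∈ V.cycles n := add_mem hx (V.bdry_mem_cycles n u)
  cases n with
  | zero => trivial
  | succ n =>
    simp only [SVect.normCycles, Submodule.mem_iInf, LinearMap.mem_ker]
    -- The projection kills d_1, d_2, …; on a cycle the vanishing of ∂ then gives that of d_0.
    have hs : ∀ j : Fin (n + 1), (V.δ j.succ).hom (x + V.bdrySucc (n + 1) u) = 0 := by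
      intro j
      have := congrArg (fun f => f.hom x)
        (HigherFacesVanish.of_P (X := V) (n + 1) n j (by omega))
      rw [← hu]
      exact this
    intro r
    induction r using Fin.cases with
    | succ j => exact hs j
    | zero =>
      have hc' : V.bdrySucc n (x + V.bdrySucc (n + 1) u) = 0 := hc
      rw [SVect.bdrySucc, LinearMap.sum_apply, Fin.sum_univ_succ,
        Finset.sum_eq_zero (fun j _ => hs j), add_zero] at hc'
      exact hc'

/-! ### The simplicial subspace generated by an element -/

/-- The simplicial subspace of `V` generated by an element of degree `q`. -/
def SVect.gen (V : SVect.{u}) {q : ℕ} (z : V.deg q) : SVect.{u} where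
  obj n := ModuleCat.of (ZMod 2) (Submodule.span (ZMod 2)
    (Set.range fun a : n.unop ⟶ SimplexCategory.mk q => (V.map a.op).hom z))
  map b := ModuleCat.ofHom ((V.map b).hom.restrict (by
    intro x hx
    induction hx using Submodule.span_induction with
    | mem x hx =>
      obtain ⟨a, rfl⟩ := hx
      refine Submodule.subset_span ⟨b.unop ≫ a, ?_⟩
      simp
    | zero => rw [map_zero]; exact zero_mem _
    | add x y _ _ hx hy => rw [map_add]; exact add_mem hx hy
    | smul c x _ hx => rw [map_smul]; exact Submodule.smul_mem _ c hx))
  map_id n := by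
    ext x
    simp
  map_comp f g := by
    ext x
    simp

/-- The inclusion of the simplicial subspace generated by an element. -/
def SVect.genIncl (V : SVect.{u}) {q : ℕ} (z : V.deg q) : V.gen z ⟶ V where
  app _ := ModuleCat.ofHom (Submodule.subtype _)
  naturality _ _ _ := rfl

/-- The generator of the simplicial subspace generated by an element. -/
def SVect.generator (V : SVect.{u}) {q : ℕ} (z : V.deg q) : (V.gen z).deg q :=
  ⟨z, Submodule.subset_span ⟨𝟙 _, by simp⟩⟩

theorem SVect.genIncl_injective (V : SVect.{u}) {q : ℕ} (z : V.deg q) (n : ℕ) :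
    Function.Injective (SVect.mapDeg (V.genIncl z) n) := Subtype.val_injective

theorem SVect.generator_span (V : SVect.{u}) {q : ℕ} (z : V.deg q) {n : ℕ}
    (x : (V.gen z).deg n) : x ∈ Submodule.span (ZMod 2)
      (Set.range fun a : SimplexCategory.mk n ⟶ SimplexCategory.mk q =>
        (V.gen z).act a (V.generator z)) := by
  obtain ⟨x, hx⟩ := x
  induction hx using Submodule.span_induction with
  | mem x hx =>
    obtain ⟨a, rfl⟩ := hx
    exact Submodule.subset_span ⟨a, rfl⟩
  | zero => exact zero_mem _
  | add x y _ _ hx hy => exact add_mem hx hy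
  | smul c x _ hx => exact Submodule.smul_mem _ c hx

open AlgebraicTopology AlgebraicTopology.DoldKan in
/-- Cycles above the degree of the generator are boundaries. -/
theorem SVect.gen_exists_bdry (V : SVect.{u}) {q : ℕ} (z : V.deg q) {n : ℕ} (hn : q < n)
    {x : (V.gen z).deg n} (hx : x ∈ (V.gen z).cycles n) : ∃ u, x = (V.gen z).bdrySucc n u := by
  obtain ⟨u, hu⟩ := (V.gen z).exists_normalize_eq n hx
  -- For n > q no operator [n] → [q] is injective, so every element of degree n is a sum of
  -- degenerate ones, which the projection kills.
  have h0 : (V.gen z).normalize n x = 0 := by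
    have hs : Submodule.span (ZMod 2) (Set.range fun a : SimplexCategory.mk n ⟶
        SimplexCategory.mk q => (V.gen z).act a (V.generator z)) ≤
          LinearMap.ker ((V.gen z).normalize n) := by
      rw [Submodule.span_le]
      rintro _ ⟨a, rfl⟩
      have := degeneracy_comp_PInfty (V.gen z) n a fun h =>
        absurd (SimplexCategory.le_of_mono a) (by omega)
      exact congrArg (fun f => f.hom (V.generator z)) this
    exact hs (V.generator_span z x)
  refine ⟨u, ?_⟩
  rw [h0] at hu
  rw [eq_neg_of_add_eq_zero_left hu.symm]
  exact ZModModule.neg_eq_self _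

/-! ### Symmetric tensors modulo norms -/

section Tensor

variable {M : Type u} [AddCommGroup M] [Module (ZMod 2) M]

/-- The norm `t ↦ t + T t` of the exchange of the two factors. -/
def tensorNorm (M : Type u) [AddCommGroup M] [Module (ZMod 2) M] :
    (M ⊗[ZMod 2] M) →ₗ[ZMod 2] (M ⊗[ZMod 2] M) :=
  LinearMap.id + (TensorProduct.comm (ZMod 2) M M).toLinearMap

theorem tensorNorm_apply (t : M ⊗[ZMod 2] M) :
    tensorNorm M t = t + TensorProduct.comm (ZMod 2) M M t := rfl

theorem tmul_add_self (v w : M) : (v + w) ⊗ₜ[ZMod 2] (v + w) =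
    v ⊗ₜ v + w ⊗ₜ w + tensorNorm M (v ⊗ₜ w) := by
  rw [tensorNorm_apply, TensorProduct.comm_tmul, TensorProduct.add_tmul, TensorProduct.tmul_add,
    TensorProduct.tmul_add]
  abel

theorem sum_tmul_sum {ι : Type*} (s : Finset ι) (v : ι → M) :
    ∃ g, (∑ r ∈ s, v r) ⊗ₜ[ZMod 2] (∑ r ∈ s, v r) = ∑ r ∈ s, v r ⊗ₜ v r + tensorNorm M g := by
  classical
  induction s using Finset.induction_on with
  | empty => exact ⟨0, by simp⟩
  | insert a s ha ih =>
    obtain ⟨g, hg⟩ := ih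
    refine ⟨g + v a ⊗ₜ (∑ r ∈ s, v r), ?_⟩
    rw [Finset.sum_insert ha, Finset.sum_insert ha, tmul_add_self, hg, map_add]
    abel

/-- For a linear form f, the symmetric functional x ⊗ y ↦ f(x)f(y) kills norms and takes the value
f(v)² on v ⊗ v. -/
theorem eq_zero_of_tmul_self_eq_tensorNorm {v : M} {g : M ⊗[ZMod 2] M}
    (h : v ⊗ₜ v = tensorNorm M g) : v = 0 := by
  refine (Module.forall_dual_apply_eq_zero_iff (ZMod 2) v).mp fun f => ?_
  let φ : (M ⊗[ZMod 2] M) →ₗ[ZMod 2] ZMod 2 :=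
    LinearMap.mul' (ZMod 2) (ZMod 2) ∘ₗ TensorProduct.map f f
  have hφ : φ ∘ₗ (TensorProduct.comm (ZMod 2) M M).toLinearMap = φ := by
    apply TensorProduct.ext'
    intro x y
    simp [φ, mul_comm]
  have h0 : φ (tensorNorm M g) = 0 := by
    have := LinearMap.congr_fun hφ g
    rw [tensorNorm_apply, map_add]
    exact (congrArg (φ g + ·) this).trans (ZModModule.add_self _)
  rw [← h] at h0
  exact mul_self_eq_zero.mp h0

/-- In an ordered basis a symmetric tensor is its strict upper triangle, the mirror image of that,
and its diagonal. The first two form a norm, and a sum of squares b ⊗ b is the square of the sum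
modulo norms. -/
theorem exists_eq_tensorNorm_add_tmul_self {s : M ⊗[ZMod 2] M}
    (hs : tensorNorm M s = 0) : ∃ g v, s = tensorNorm M g + v ⊗ₜ v := by
  replace hs : TensorProduct.comm (ZMod 2) M M s = s :=
    (eq_neg_of_add_eq_zero_right hs).trans (ZModModule.neg_eq_self _)
  let b := Module.Basis.ofVectorSpace (ZMod 2) M
  let ι := Module.Basis.ofVectorSpaceIndex (ZMod 2) M
  classical
  let : LinearOrder ι := linearOrderOfSTO WellOrderingRel
  let B := b.tensorProduct b
  -- P is the projection to the strict upper triangle, Q the projection to the diagonal.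
  let P : (M ⊗[ZMod 2] M) →ₗ[ZMod 2] (M ⊗[ZMod 2] M) :=
    B.constr ℕ fun p => if p.1 < p.2 then b p.1 ⊗ₜ b p.2 else 0
  let Q : (M ⊗[ZMod 2] M) →ₗ[ZMod 2] (M ⊗[ZMod 2] M) :=
    B.constr ℕ fun p => if p.1 = p.2 then b p.1 ⊗ₜ b p.2 else 0
  let T := (TensorProduct.comm (ZMod 2) M M).toLinearMap
  have hP : ∀ i j, P (b i ⊗ₜ b j) = if i < j then b i ⊗ₜ b j else 0 := by
    intro i j
    have := B.constr_basis ℕ (fun p => if p.1 < p.2 then b p.1 ⊗ₜ[ZMod 2] b p.2 else 0) (i, j)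
    rwa [Module.Basis.tensorProduct_apply] at this
  have hQ : ∀ i j, Q (b i ⊗ₜ b j) = if i = j then b i ⊗ₜ b j else 0 := by
    intro i j
    have := B.constr_basis ℕ (fun p => if p.1 = p.2 then b p.1 ⊗ₜ[ZMod 2] b p.2 else 0) (i, j)
    rwa [Module.Basis.tensorProduct_apply] at this
  have hsum : P + T ∘ₗ P ∘ₗ T + Q = LinearMap.id := by
    refine B.ext fun p => ?_
    rw [Module.Basis.tensorProduct_apply]
    simp only [LinearMap.add_apply, LinearMap.comp_apply, LinearMap.id_apply, T,
      LinearEquiv.coe_coe, TensorProduct.comm_tmul, hP, hQ]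
    rcases lt_trichotomy p.1 p.2 with h | h | h
    · simp [h, h.ne, h.not_gt]
    · simp [h]
    · simp [h, h.ne', h.not_gt]
  have hQs : ∀ t, ∃ g v, Q t = tensorNorm M g + v ⊗ₜ v := by
    intro t
    have ht : t ∈ Submodule.span (ZMod 2) (Set.range B) := B.mem_span t
    induction ht using Submodule.span_induction with
    | mem x hx =>
      obtain ⟨p, rfl⟩ := hx
      rw [Module.Basis.tensorProduct_apply, hQ]
      split_ifs with h
      · exact ⟨0, b p.1, by rw [map_zero, zero_add, h]⟩
      · exact ⟨0, 0, by simp⟩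
    | zero => exact ⟨0, 0, by simp⟩
    | add x y _ _ hx hy =>
      obtain ⟨g, v, h⟩ := hx
      obtain ⟨g', v', h'⟩ := hy
      refine ⟨g + g' + v ⊗ₜ v', v + v', ?_⟩
      have h2 : tensorNorm M (v ⊗ₜ v') + tensorNorm M (v ⊗ₜ v') = 0 := ZModModule.add_self _
      rw [map_add, h, h', tmul_add_self, map_add, map_add]
      rw [← add_zero (tensorNorm M g + v ⊗ₜ v + (tensorNorm M g' + v' ⊗ₜ v')), ← h2]
      abel
    | smul c x _ hx =>
      obtain ⟨g, v, h⟩ := hx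
      have hc : c * c = c := by revert c; decide
      exact ⟨c • g, c • v, by rw [map_smul, h, smul_add, map_smul, TensorProduct.smul_tmul_smul, hc]⟩
  obtain ⟨g, v, h⟩ := hQs s
  refine ⟨P s + g, v, ?_⟩
  have h1 := LinearMap.congr_fun hsum s
  simp only [LinearMap.add_apply, LinearMap.comp_apply, LinearMap.id_apply, T,
    LinearEquiv.coe_coe, hs] at h1
  rw [map_add, tensorNorm_apply, add_assoc, ← h]
  exact h1.symm

end Tensor

/-! ### The differential of the tensor product -/

/-- The degreewise tensor product of two simplicial vector spaces. -/
def SVect.tensor (V W : SVect.{u}) : SVect.{u} where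
  obj n := ModuleCat.of (ZMod 2) (V.obj n ⊗[ZMod 2] W.obj n)
  map a := ModuleCat.ofHom (TensorProduct.map (V.map a).hom (W.map a).hom)
  map_id n := by
    ext : 1
    simp
  map_comp f g := by
    ext : 1
    simp [TensorProduct.map_comp]

/-- The differential `∑_r d_r ⊗ d_r` of `C(V ⊗ W)`. -/
def SVect.tensorBdry (V W : SVect.{u}) (m : ℕ) :
    (V.deg (m + 1) ⊗[ZMod 2] W.deg (m + 1)) →ₗ[ZMod 2] (V.deg m ⊗[ZMod 2] W.deg m) :=
  ∑ r : Fin (m + 2), TensorProduct.map (V.act (SimplexCategory.δ r)) (W.act (SimplexCategory.δ r))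

theorem SVect.tensorBdry_tmul (V W : SVect.{u}) (m : ℕ) (x : V.deg (m + 1)) (y : W.deg (m + 1)) :
    V.tensorBdry W m (x ⊗ₜ y) = ∑ r : Fin (m + 2),
      V.act (SimplexCategory.δ r) x ⊗ₜ W.act (SimplexCategory.δ r) y := by
  rw [SVect.tensorBdry, LinearMap.sum_apply]
  rfl

theorem SVect.tensorBdry_tensorBdry (V W : SVect.{u}) (m : ℕ)
    (t : V.deg (m + 2) ⊗[ZMod 2] W.deg (m + 2)) :
    V.tensorBdry W m (V.tensorBdry W (m + 1) t) = 0 :=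
  (V.tensor W).bdrySucc_bdrySucc m t

theorem SVect.bdrySucc_apply (V : SVect.{u}) (n : ℕ) (x : V.deg (n + 1)) :
    V.bdrySucc n x = ∑ r : Fin (n + 2), V.act (SimplexCategory.δ r) x := by
  rw [SVect.bdrySucc, LinearMap.sum_apply]
  rfl

theorem SVect.tensorBdry_eq_app (V W : SVect.{u}) (m : ℕ) : V.tensorBdry W m =
    (∑ r : Fin (m + 2), EMTrans.ofOps (SimplexCategory.δ r) (SimplexCategory.δ r)).app V W := by
  rw [EMTrans.sum_app]
  rfl

theorem SVect.tensorBdry_map {V V' : SVect.{u}} (f : V ⟶ V') (m : ℕ)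
    (t : V.deg (m + 1) ⊗[ZMod 2] V.deg (m + 1)) :
    TensorProduct.map (SVect.mapDeg f m) (SVect.mapDeg f m) (V.tensorBdry V m t) =
      V'.tensorBdry V' m (TensorProduct.map (SVect.mapDeg f (m + 1)) (SVect.mapDeg f (m + 1)) t) := by
  rw [SVect.tensorBdry_eq_app, SVect.tensorBdry_eq_app]
  exact LinearMap.congr_fun (EMTrans.natural _ f f) t

theorem SVect.tensorBdry_tensorNorm (V : SVect.{u}) (m : ℕ)
    (t : V.deg (m + 1) ⊗[ZMod 2] V.deg (m + 1)) :
    V.tensorBdry V m (tensorNorm _ t) = tensorNorm _ (V.tensorBdry V m t) := by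
  have h : V.tensorBdry V m ∘ₗ (TensorProduct.comm (ZMod 2) _ _).toLinearMap =
      (TensorProduct.comm (ZMod 2) _ _).toLinearMap ∘ₗ V.tensorBdry V m := by
    apply TensorProduct.ext'
    intro x y
    simp [SVect.tensorBdry_tmul]
  rw [tensorNorm_apply, tensorNorm_apply, map_add]
  exact congrArg _ (LinearMap.congr_fun h t)

/-! ### The defining relations, evaluated on elements -/

namespace EMFam

variable {k : ℕ}

theorem bdryComm_app_tmul (F : EMFam.{u} k) (n p m : ℕ) (h : m + (k + 1) = n + 1 + (p + 1))
    (V W : SVect.{u}) (x : V.deg (n + 1)) (y : W.deg (p + 1)) :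
    (F.bdryComm (n + 1) (p + 1) m h).app V W (x ⊗ₜ y) =
      (F n (p + 1) m (by omega)).app V W (V.bdrySucc n x ⊗ₜ y) +
      (F (n + 1) p m (by omega)).app V W (x ⊗ₜ W.bdrySucc p y) +
      V.tensorBdry W m ((F (n + 1) (p + 1) (m + 1) (by omega)).app V W (x ⊗ₜ y)) := by
  have e1 : (∑ r : Fin (n + 2), EMTrans.ofOps.{u} (SimplexCategory.δ r)
      (𝟙 (SimplexCategory.mk (p + 1)))).app V W (x ⊗ₜ y) = V.bdrySucc n x ⊗ₜ y := by
    rw [EMTrans.sum_app, LinearMap.sum_apply, SVect.bdrySucc_apply, TensorProduct.sum_tmul]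
    simp [EMTrans.ofOps]
  have e2 : (∑ r : Fin (p + 2), EMTrans.ofOps.{u} (𝟙 (SimplexCategory.mk (n + 1)))
      (SimplexCategory.δ r)).app V W (x ⊗ₜ y) = x ⊗ₜ W.bdrySucc p y := by
    rw [EMTrans.sum_app, LinearMap.sum_apply, SVect.bdrySucc_apply, TensorProduct.tmul_sum]
    simp [EMTrans.ofOps]
  rw [bdryComm, bdryLeft_succ, bdryRight_succ, EMTrans.add_app, EMTrans.add_app,
    LinearMap.add_apply, LinearMap.add_apply]
  simp only [EMTrans.comp, LinearMap.comp_apply, bdryPost]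
  rw [e1, e2, SVect.tensorBdry_eq_app]

end EMFam

namespace IsHigherEilenbergMacLane

theorem succ_tmul {D : (k : ℕ) → EMFam.{u} k} (hD : IsHigherEilenbergMacLane D)
    (k n p m : ℕ) (h : m + (k + 1) = n + 1 + (p + 1)) (hk : 2 * (k + 1) ≤ n + 1 + (p + 1))
    (hne : ¬ (n = k ∧ p = k)) (V W : SVect.{u}) (x : V.deg (n + 1)) (y : W.deg (p + 1)) :
    (D (k + 1) (n + 1) (p + 1) m h).app V W (x ⊗ₜ y) + TensorProduct.comm (ZMod 2) _ _
        ((D (k + 1) (p + 1) (n + 1) m (by omega)).app W V (y ⊗ₜ x)) =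
      (D k n (p + 1) m (by omega)).app V W (V.bdrySucc n x ⊗ₜ y) +
      (D k (n + 1) p m (by omega)).app V W (x ⊗ₜ W.bdrySucc p y) +
      V.tensorBdry W m ((D k (n + 1) (p + 1) (m + 1) (by omega)).app V W (x ⊗ₜ y)) := by
  have e := hD.succ k (n + 1) (p + 1) m h hk
  have hφ : EMFam.phi.{u} (k + 1) (n + 1) (p + 1) m h = 0 := dif_neg (by omega)
  rw [hφ, add_zero] at e
  have e' := LinearMap.congr_fun (congrArg (fun F => F.app V W) e) (x ⊗ₜ y)
  rw [← EMFam.bdryComm_app_tmul]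
  exact e'

theorem zero_tmul {D : (k : ℕ) → EMFam.{u} k} (hD : IsHigherEilenbergMacLane D)
    (i j m : ℕ) (h : m + 0 = i + j) (hij : 0 < i + j)
    (V W : SVect.{u}) (x : V.deg i) (y : W.deg j) :
    (D 0 i j m h).app V W (x ⊗ₜ y) + TensorProduct.comm (ZMod 2) _ _
        ((D 0 j i m (by omega)).app W V (y ⊗ₜ x)) =
      (EMFam.eilenbergMacLane i j m h).app V W (x ⊗ₜ y) := by
  have e := hD.zero i j m h
  have hφ : EMFam.phi.{u} 0 i j m h = 0 := dif_neg (by omega)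
  rw [hφ, add_zero] at e
  exact LinearMap.congr_fun (congrArg (fun F => F.app V W) e) (x ⊗ₜ y)

end IsHigherEilenbergMacLane

/-! ### Products in a simplicial commutative algebra -/

theorem SAlg.bdrySucc_mulMap (R : SAlg.{u}) (m : ℕ)
    (t : R.toVect.deg (m + 1) ⊗[ZMod 2] R.toVect.deg (m + 1)) :
    R.toVect.bdrySucc m (R.mulMap (m + 1) t) = R.mulMap m (R.toVect.tensorBdry R.toVect m t) := by
  have h : R.toVect.bdrySucc m ∘ₗ R.mulMap (m + 1) =
      R.mulMap m ∘ₗ R.toVect.tensorBdry R.toVect m := by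
    apply TensorProduct.ext'
    intro x y
    rw [LinearMap.comp_apply, LinearMap.comp_apply, SVect.bdrySucc_apply, SVect.tensorBdry_tmul,
      map_sum]
    refine Finset.sum_congr rfl fun r _ => ?_
    exact map_mul (M := R.deg (m + 1)) (N := R.deg m) (R.map (SimplexCategory.δ r).op).hom x y
  exact LinearMap.congr_fun h t

theorem SAlg.mulMap_comm (R : SAlg.{u}) (m : ℕ)
    (t : R.toVect.deg m ⊗[ZMod 2] R.toVect.deg m) :
    R.mulMap m (TensorProduct.comm (ZMod 2) _ _ t) = R.mulMap m t := by
  have h : R.mulMap m ∘ₗ (TensorProduct.comm (ZMod 2) _ _).toLinearMap = R.mulMap m := by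
    apply TensorProduct.ext'
    intro x y
    exact mul_comm (G := R.deg m) y x
  exact LinearMap.congr_fun h t

theorem SAlg.mulMap_tensorNorm (R : SAlg.{u}) (m : ℕ)
    (t : R.toVect.deg m ⊗[ZMod 2] R.toVect.deg m) : R.mulMap m (tensorNorm _ t) = 0 := by
  rw [tensorNorm_apply, map_add, R.mulMap_comm]
  exact ZModModule.add_self _

/-- The product `μ D^k(x ⊗ y)`. -/
def emProd (D : (k : ℕ) → EMFam.{u} k) (R : SAlg.{u}) (k i j m : ℕ) (h : m + k = i + j)
    (x : R.toVect.deg i) (y : R.toVect.deg j) : R.toVect.deg m :=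
  R.mulMap m ((D k i j m h).app R.toVect R.toVect (x ⊗ₜ y))

/-! ### Products μD^k(x ⊗ y): cycles and dependence on the class of x. -/

section emProd

variable {D : (k : ℕ) → EMFam.{u} k} {R : SAlg.{u}}

theorem emProd_add_left (k i j m : ℕ) (h : m + k = i + j) (x x' : R.toVect.deg i)
    (y : R.toVect.deg j) :
    emProd D R k i j m h (x + x') y = emProd D R k i j m h x y + emProd D R k i j m h x' y := by
  simp only [emProd, TensorProduct.add_tmul, map_add]

theorem emProd_add_right (k i j m : ℕ) (h : m + k = i + j) (x : R.toVect.deg i)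
    (y y' : R.toVect.deg j) :
    emProd D R k i j m h x (y + y') = emProd D R k i j m h x y + emProd D R k i j m h x y' := by
  simp only [emProd, TensorProduct.tmul_add, map_add]

@[simp] theorem emProd_zero_left (k i j m : ℕ) (h : m + k = i + j) (y : R.toVect.deg j) :
    emProd D R k i j m h 0 y = 0 := by
  simp only [emProd, TensorProduct.zero_tmul, map_zero]

@[simp] theorem emProd_zero_right (k i j m : ℕ) (h : m + k = i + j) (x : R.toVect.deg i) :
    emProd D R k i j m h x 0 = 0 := by
  simp only [emProd, TensorProduct.tmul_zero, map_zero]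

theorem emProd_succ (hD : IsHigherEilenbergMacLane D) (k n p m : ℕ)
    (h : m + (k + 1) = n + 1 + (p + 1)) (hk : 2 * (k + 1) ≤ n + 1 + (p + 1))
    (hne : ¬ (n = k ∧ p = k)) (x : R.toVect.deg (n + 1)) (y : R.toVect.deg (p + 1)) :
    emProd D R (k + 1) (n + 1) (p + 1) m h x y +
        emProd D R (k + 1) (p + 1) (n + 1) m (by omega) y x =
      emProd D R k n (p + 1) m (by omega) (R.toVect.bdrySucc n x) y +
      emProd D R k (n + 1) p m (by omega) x (R.toVect.bdrySucc p y) +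
      R.toVect.bdrySucc m (emProd D R k (n + 1) (p + 1) (m + 1) (by omega) x y) := by
  have e := congrArg (R.mulMap m) (hD.succ_tmul k n p m h hk hne R.toVect R.toVect x y)
  rw [map_add, map_add, map_add, R.mulMap_comm, ← R.bdrySucc_mulMap] at e
  exact e

/-- The relation of level k + 1 on x ⊗ x has a left side that doubles after multiplication. For k =
q - i the bound k + 1 ≤ n says i ≥ 2 and keeps φ_{k+1}, which would contribute x², out of the
relation. -/
theorem bdrySucc_emProd_self (hD : IsHigherEilenbergMacLane D) (k n m : ℕ)
    (h : m + 1 + k = n + 1 + (n + 1)) (hk : k + 1 ≤ n) {x : R.toVect.deg (n + 1)}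
    (hx : R.toVect.bdrySucc n x = 0) :
    R.toVect.bdrySucc m (emProd D R k (n + 1) (n + 1) (m + 1) h x x) = 0 := by
  have e := emProd_succ hD k n n m (by omega) (by omega) (by omega) x x
  rw [hx, emProd_zero_left, emProd_zero_right, zero_add, zero_add] at e
  exact e.symm.trans (ZModModule.add_self _)

/-- After multiplication the cross terms are the left side of the relation of level k on x ⊗ ∂w,
where both ∂x and ∂∂w vanish. For k = 0 the right side is D(x ⊗ ∂w) = ∂D(x ⊗ w). -/
theorem emProd_cross (hD : IsHigherEilenbergMacLane D) (k n m : ℕ)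
    (h : m + k = n + 1 + (n + 1)) (hk : k + 1 ≤ n) {x : R.toVect.deg (n + 1)}
    (hx : R.toVect.bdrySucc n x = 0) (w : R.toVect.deg (n + 2)) :
    ∃ t, emProd D R k (n + 1) (n + 1) m h x (R.toVect.bdrySucc (n + 1) w) +
      emProd D R k (n + 1) (n + 1) m h (R.toVect.bdrySucc (n + 1) w) x =
        R.toVect.bdrySucc m t := by
  cases k with
  | zero =>
    have e := congrArg (R.mulMap m) (hD.zero_tmul (n + 1) (n + 1) m h (by omega)
      R.toVect R.toVect x (R.toVect.bdrySucc (n + 1) w))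
    rw [map_add, R.mulMap_comm] at e
    have e' := EMFam.bdryComm_app_tmul EMFam.eilenbergMacLane n (n + 1) m (by omega)
      R.toVect R.toVect x w
    rw [EMFam.bdryComm_eilenbergMacLane, hx, TensorProduct.zero_tmul, map_zero, zero_add] at e'
    have e2 := (eq_neg_of_add_eq_zero_left e'.symm).trans (ZModModule.neg_eq_self _)
    rw [e2, ← R.bdrySucc_mulMap] at e
    exact ⟨_, e⟩
  | succ k =>
    have e := emProd_succ hD k n n m h (by omega) (by omega) x (R.toVect.bdrySucc (n + 1) w)
    rw [hx, SVect.bdrySucc_bdrySucc, emProd_zero_left, emProd_zero_right, zero_add, zero_add] at e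
    exact ⟨_, e⟩

/-- Two relations combine. Level k + 2 on w ⊗ w makes the symmetrized product μD^{k+1} of w and ∂w a
boundary; level k + 1 on w ⊗ ∂w equates it with μD^k(∂w ⊗ ∂w) plus a boundary. -/
theorem emProd_bdry_bdry (hD : IsHigherEilenbergMacLane D) (k n m : ℕ)
    (h : m + k = n + 1 + (n + 1)) (hk : k + 1 ≤ n) (w : R.toVect.deg (n + 2)) :
    ∃ t, emProd D R k (n + 1) (n + 1) m h (R.toVect.bdrySucc (n + 1) w)
      (R.toVect.bdrySucc (n + 1) w) = R.toVect.bdrySucc m t := by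
  have e1 := emProd_succ hD (k + 1) (n + 1) (n + 1) m (by omega) (by omega) (by omega) w w
  have e2 := emProd_succ hD k (n + 1) n m (by omega) (by omega) (by omega) w
    (R.toVect.bdrySucc (n + 1) w)
  rw [show emProd D R (k + 1 + 1) (n + 1 + 1) (n + 1 + 1) m (by omega) w w +
    emProd D R (k + 1 + 1) (n + 1 + 1) (n + 1 + 1) m (by omega) w w = 0 from
      ZModModule.add_self _, add_comm (emProd D R (k + 1) (n + 1) _ _ _ _ _), e2,
    SVect.bdrySucc_bdrySucc, emProd_zero_right, add_zero, add_assoc, ← map_add] at e1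
  exact ⟨_, (eq_neg_of_add_eq_zero_left e1.symm).trans (ZModModule.neg_eq_self _)⟩

/-- The class of `μ D^k(x ⊗ x)` depends only on the class of the cycle `x`. -/
theorem emProd_self_add_bdry (hD : IsHigherEilenbergMacLane D) (k n m : ℕ)
    (h : m + k = n + 1 + (n + 1)) (hk : k + 1 ≤ n) {x : R.toVect.deg (n + 1)}
    (hx : R.toVect.bdrySucc n x = 0) (w : R.toVect.deg (n + 2)) :
    ∃ t, emProd D R k (n + 1) (n + 1) m h (x + R.toVect.bdrySucc (n + 1) w)
      (x + R.toVect.bdrySucc (n + 1) w) =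
        emProd D R k (n + 1) (n + 1) m h x x + R.toVect.bdrySucc m t := by
  obtain ⟨t, ht⟩ := emProd_cross hD k n m h hk hx w
  obtain ⟨t', ht'⟩ := emProd_bdry_bdry hD k n m h hk w
  refine ⟨t + t', ?_⟩
  rw [emProd_add_left, emProd_add_right, emProd_add_right, map_add, ← ht, ← ht']
  abel

end emProd

/-! ### Independence of the choice of higher Eilenberg-MacLane maps -/

/-- In a simplicial vector space without homotopy in degree `m`, symmetric tensors in degree `m`
whose differential is a norm are norms up to boundaries. -/
theorem SVect.exists_norm_add_bdry (V : SVect.{u}) {m : ℕ}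
    (hV : ∀ x : V.deg (m + 1), V.bdrySucc m x = 0 → ∃ u, x = V.bdrySucc (m + 1) u)
    {s : V.deg (m + 1) ⊗[ZMod 2] V.deg (m + 1)} (hs : tensorNorm _ s = 0)
    (hb : ∃ g, V.tensorBdry V m s = tensorNorm _ g) :
    ∃ g t, s = tensorNorm _ g + V.tensorBdry V (m + 1) t := by
  obtain ⟨g, v, rfl⟩ := exists_eq_tensorNorm_add_tmul_self hs
  obtain ⟨g', hg'⟩ := hb
  -- Modulo norms ∂(v ⊗ v) is ∂v ⊗ ∂v. This is then itself a norm, and a square v ⊗ v is a norm only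
  -- if v = 0.
  have hv : V.bdrySucc m v = 0 := by
    obtain ⟨g'', h''⟩ := sum_tmul_sum Finset.univ
      (fun r : Fin (m + 2) => V.act (SimplexCategory.δ r) v)
    rw [← SVect.bdrySucc_apply, ← SVect.tensorBdry_tmul] at h''
    rw [map_add, SVect.tensorBdry_tensorNorm] at hg'
    refine eq_zero_of_tmul_self_eq_tensorNorm (g := g' - V.tensorBdry V m g + g'') ?_
    rw [h'', map_add, map_sub, ← hg', add_sub_cancel_left]
  obtain ⟨u, rfl⟩ := hV v hv
  obtain ⟨g'', h''⟩ := sum_tmul_sum Finset.univ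
    (fun r : Fin (m + 3) => V.act (SimplexCategory.δ r) u)
  rw [← SVect.bdrySucc_apply, ← SVect.tensorBdry_tmul] at h''
  -- By the same computation one degree higher, ∂(u ⊗ u) is ∂u ⊗ ∂u up to a norm.
  refine ⟨g + g'', u ⊗ₜ u, ?_⟩
  rw [h'', map_add]
  abel

theorem IsHigherEilenbergMacLane.tensorNorm_tmul_self {D : (k : ℕ) → EMFam.{u} k}
    (hD : IsHigherEilenbergMacLane D) (V : SVect.{u}) {n : ℕ} {z : V.deg (n + 1)}
    (hz : V.bdrySucc n z = 0) (k m : ℕ) (h : m + 1 + k = n + 1 + (n + 1)) (hk : k + 1 ≤ n) :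
    tensorNorm _ ((D (k + 1) (n + 1) (n + 1) m (by omega)).app V V (z ⊗ₜ z)) =
      V.tensorBdry V m ((D k (n + 1) (n + 1) (m + 1) h).app V V (z ⊗ₜ z)) := by
  have e := hD.succ_tmul k n n m (by omega) (by omega) (by omega) V V z z
  rw [hz, TensorProduct.zero_tmul, TensorProduct.tmul_zero, map_zero, map_zero, zero_add,
    zero_add] at e
  exact e

/-- The difference of two choices, evaluated on `z ⊗ z` for a cycle `z`. -/
theorem exists_difference {D D' : (k : ℕ) → EMFam.{u} k} (hD : IsHigherEilenbergMacLane D)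
    (hD' : IsHigherEilenbergMacLane D') (V : SVect.{u}) (n : ℕ) (z : V.deg (n + 1))
    (hz : V.bdrySucc n z = 0)
    (hV : ∀ m, n + 1 < m + 1 → ∀ x : V.deg (m + 1), V.bdrySucc m x = 0 →
      ∃ u, x = V.bdrySucc (m + 1) u)
    (k m : ℕ) (h : m + k = n + 1 + (n + 1)) (hk : k + 1 ≤ n) :
    ∃ g t, (D k (n + 1) (n + 1) m h).app V V (z ⊗ₜ z) +
      (D' k (n + 1) (n + 1) m h).app V V (z ⊗ₜ z) = tensorNorm _ g + V.tensorBdry V m t := by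
  induction k generalizing m with
  | zero =>
    obtain ⟨m, rfl⟩ : ∃ m', m = m' + 1 := ⟨m - 1, by omega⟩
    -- s_0 is symmetric because both choices have the same symmetrization D(z ⊗ z), and ∂s_0 = Ns_1.
    refine V.exists_norm_add_bdry (hV m (by omega)) ?_
      ⟨(D 1 (n + 1) (n + 1) m (by omega)).app V V (z ⊗ₜ z) +
        (D' 1 (n + 1) (n + 1) m (by omega)).app V V (z ⊗ₜ z), ?_⟩
    · have e := hD.zero_tmul (n + 1) (n + 1) (m + 1) h (by omega) V V z z
      have e' := hD'.zero_tmul (n + 1) (n + 1) (m + 1) h (by omega) V V z z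
      rw [map_add]
      exact (congrArg₂ (· + ·) e e').trans (ZModModule.add_self _)
    · rw [map_add, ← hD.tensorNorm_tmul_self V hz 0 m h hk, ← hD'.tensorNorm_tmul_self V hz 0 m h hk, ← map_add]
  | succ k ih =>
    obtain ⟨g, t, hgt⟩ := ih (m + 1) (by omega) (by omega)
    obtain ⟨m, rfl⟩ : ∃ m', m = m' + 1 := ⟨m - 1, by omega⟩
    have e0 := congrArg (V.tensorBdry V (m + 1)) hgt
    rw [map_add, map_add, SVect.tensorBdry_tensorBdry, add_zero, SVect.tensorBdry_tensorNorm,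
      ← hD.tensorNorm_tmul_self V hz k (m + 1) (by omega) (by omega), ← hD'.tensorNorm_tmul_self V hz k (m + 1) (by omega) (by omega),
      ← map_add] at e0
    -- If s_k = Ng + ∂t, then Ns_{k+1} = ∂s_k = N∂g. So the correction s_{k+1} + ∂g is symmetric,
    -- and its differential ∂s_{k+1} = Ns_{k+2} is again a norm.
    obtain ⟨g', t', h'⟩ := V.exists_norm_add_bdry (hV m (by omega))
      (s := (D (k + 1) (n + 1) (n + 1) (m + 1) h).app V V (z ⊗ₜ z) +
        (D' (k + 1) (n + 1) (n + 1) (m + 1) h).app V V (z ⊗ₜ z) +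
        V.tensorBdry V (m + 1) g) (by rw [map_add, e0]; exact ZModModule.add_self _) (by
        refine ⟨(D (k + 2) (n + 1) (n + 1) m (by omega)).app V V (z ⊗ₜ z) +
          (D' (k + 2) (n + 1) (n + 1) m (by omega)).app V V (z ⊗ₜ z), ?_⟩
        rw [map_add, map_add, SVect.tensorBdry_tensorBdry, add_zero, map_add,
          hD.tensorNorm_tmul_self V hz (k + 1) m h hk, hD'.tensorNorm_tmul_self V hz (k + 1) m h hk])
    refine ⟨g', t' + g, ?_⟩
    rw [map_add, ← add_assoc, ← h', add_assoc]
    rw [show V.tensorBdry V (m + 1) g + V.tensorBdry V (m + 1) g = 0 from ZModModule.add_self _,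
      add_zero]

/-- R may have homotopy in the degrees concerned, but the subspace generated by z does not. The
comparison is made there, carried to R by naturality, and multiplied, which kills the norm. -/
theorem emProd_choice {D D' : (k : ℕ) → EMFam.{u} k} (hD : IsHigherEilenbergMacLane D)
    (hD' : IsHigherEilenbergMacLane D') (R : SAlg.{u}) (k n m : ℕ)
    (h : m + k = n + 1 + (n + 1)) (hk : k + 1 ≤ n) {z : R.toVect.deg (n + 1)}
    (hz : z ∈ R.toVect.cycles (n + 1)) :
    ∃ t, emProd D R k (n + 1) (n + 1) m h z z =
      emProd D' R k (n + 1) (n + 1) m h z z + R.toVect.bdrySucc m t := by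
  let V := R.toVect.gen z
  let ι := R.toVect.genIncl z
  let z' : V.deg (n + 1) := R.toVect.generator z
  have hι : ∀ t, SVect.mapDeg ι n (V.bdrySucc n t) =
      R.toVect.bdrySucc n (SVect.mapDeg ι (n + 1) t) := by
    intro t
    rw [SVect.bdrySucc_apply, SVect.bdrySucc_apply, map_sum]
    rfl
  have hz' : V.bdrySucc n z' = 0 := by
    refine R.toVect.genIncl_injective z n ?_
    rw [map_zero]
    exact (hι z').trans hz
  obtain ⟨g, t, hgt⟩ := exists_difference hD hD' V n z' hz'
    (fun m hm x hx => R.toVect.gen_exists_bdry z hm hx) k m h hk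
  have hn : ∀ F : EMTrans.{u} (n + 1) (n + 1) m m, F.app R.toVect R.toVect (z ⊗ₜ z) =
      TensorProduct.map (SVect.mapDeg ι m) (SVect.mapDeg ι m) (F.app V V (z' ⊗ₜ z')) :=
    fun F => (LinearMap.congr_fun (F.natural ι ι) (z' ⊗ₜ z')).symm
  have hc : ∀ g, R.mulMap m (TensorProduct.map (SVect.mapDeg ι m) (SVect.mapDeg ι m)
      (tensorNorm _ g)) = 0 := by
    intro g
    rw [tensorNorm_apply, map_add, TensorProduct.map_comm, ← tensorNorm_apply,
      R.mulMap_tensorNorm]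
  refine ⟨R.mulMap (m + 1) (TensorProduct.map (SVect.mapDeg ι (m + 1)) (SVect.mapDeg ι (m + 1)) t),
    ?_⟩
  have e : ∀ F F' : EMTrans.{u} (n + 1) (n + 1) m m,
      F.app V V (z' ⊗ₜ z') + F'.app V V (z' ⊗ₜ z') = tensorNorm _ g + V.tensorBdry V m t →
      R.mulMap m (F.app R.toVect R.toVect (z ⊗ₜ z)) =
        R.mulMap m (F'.app R.toVect R.toVect (z ⊗ₜ z)) +
        R.mulMap m (TensorProduct.map (SVect.mapDeg ι m) (SVect.mapDeg ι m)
          (V.tensorBdry V m t)) := by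
    intro F F' hF
    let L := R.mulMap m ∘ₗ TensorProduct.map (SVect.mapDeg ι m) (SVect.mapDeg ι m)
    have hL : L (F.app V V (z' ⊗ₜ z')) + L (F'.app V V (z' ⊗ₜ z')) = L (V.tensorBdry V m t) := by
      rw [← map_add, hF, map_add]
      exact (congrArg (· + L (V.tensorBdry V m t)) (hc g)).trans (zero_add _)
    rw [hn F, hn F']
    change L _ = L _ + L _
    rw [← hL, add_left_comm]
    exact (add_eq_left.mpr (ZModModule.add_self _)).symm
  rw [R.bdrySucc_mulMap, ← SVect.tensorBdry_map ι m t]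
  exact e _ _ hgt

/-! ### The homotopy operations -/

theorem SVect.cls_eq_iff (V : SVect.{u}) (n : ℕ) {x y : V.deg n} (hx : x ∈ V.cycles n)
    (hy : y ∈ V.cycles n) : V.cls n x hx = V.cls n y hy ↔ ∃ u, x = y + V.bdrySucc n u := by
  rw [SVect.cls, SVect.cls, Submodule.Quotient.eq]
  constructor
  · rintro ⟨u, hu⟩
    exact ⟨u, by rw [hu]; simp⟩
  · rintro ⟨u, rfl⟩
    exact ⟨u, by simp⟩

theorem dwyerTheta_eq_emProd (D : (k : ℕ) → EMFam.{u} k) (R : SAlg.{u}) (q i : ℕ) (hiq : i ≤ q)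
    {x : R.toVect.deg q} (hx : x ∈ R.toVect.cycles q) :
    dwyerTheta D R q i hiq x = emProd D R (q - i) q q (q + i) (by omega) x x := by
  have hx' : R.toVect.bdry q x = 0 := hx
  rw [dwyerTheta, emProd]
  convert add_zero _
  split_ifs
  · rw [hx', TensorProduct.tmul_zero, map_zero, map_zero]
  · rfl

section Operation

variable {D : (k : ℕ) → EMFam.{u} k} {R : SAlg.{u}} {q i : ℕ}

theorem dwyerTheta_mem_cycles (hD : IsHigherEilenbergMacLane D) (hi : 2 ≤ i) (hiq : i ≤ q)
    {x : R.toVect.deg q} (hx : x ∈ R.toVect.cycles q) :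
    dwyerTheta D R q i hiq x ∈ R.toVect.cycles (q + i) := by
  rw [dwyerTheta_eq_emProd D R q i hiq hx]
  obtain ⟨q, rfl⟩ : ∃ q', q = q' + 1 := ⟨q - 1, by omega⟩
  obtain ⟨i, rfl⟩ : ∃ i', i = i' + 1 := ⟨i - 1, by omega⟩
  exact bdrySucc_emProd_self hD _ q (q + 1 + i) (by omega) (by omega) hx

theorem cls_dwyerTheta_congr (hD : IsHigherEilenbergMacLane D) (hi : 2 ≤ i) (hiq : i ≤ q)
    {x y : R.toVect.deg q} (hx : x ∈ R.toVect.cycles q) (hy : y ∈ R.toVect.cycles q)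
    (hxy : R.toVect.cls q x hx = R.toVect.cls q y hy) :
    R.toVect.cls (q + i) _ (dwyerTheta_mem_cycles hD hi hiq hx) =
      R.toVect.cls (q + i) _ (dwyerTheta_mem_cycles hD hi hiq hy) := by
  obtain ⟨w, rfl⟩ := (R.toVect.cls_eq_iff q hx hy).mp hxy
  rw [SVect.cls_eq_iff, dwyerTheta_eq_emProd D R q i hiq hx, dwyerTheta_eq_emProd D R q i hiq hy]
  obtain ⟨q, rfl⟩ : ∃ q', q = q' + 1 := ⟨q - 1, by omega⟩
  exact emProd_self_add_bdry hD _ q _ (by omega) (by omega) hy w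

theorem cls_dwyerTheta_choice {D' : (k : ℕ) → EMFam.{u} k} (hD : IsHigherEilenbergMacLane D)
    (hD' : IsHigherEilenbergMacLane D') (hi : 2 ≤ i) (hiq : i ≤ q)
    {x : R.toVect.deg q} (hx : x ∈ R.toVect.cycles q) :
    R.toVect.cls (q + i) _ (dwyerTheta_mem_cycles hD hi hiq hx) =
      R.toVect.cls (q + i) _ (dwyerTheta_mem_cycles hD' hi hiq hx) := by
  rw [SVect.cls_eq_iff, dwyerTheta_eq_emProd D R q i hiq hx, dwyerTheta_eq_emProd D' R q i hiq hx]
  obtain ⟨q, rfl⟩ : ∃ q', q = q' + 1 := ⟨q - 1, by omega⟩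
  exact emProd_choice hD hD' R _ q _ (by omega) (by omega) hx

end Operation

theorem SVect.exists_cycle (V : SVect.{u}) (n : ℕ) (c : V.homotopy n) :
    ∃ x : V.cycles n, V.cls n x x.2 = c := by
  obtain ⟨x, rfl⟩ := Submodule.Quotient.mk_surjective _ c
  exact ⟨x, rfl⟩

theorem SVect.exists_normCycle_cls (V : SVect.{u}) (n : ℕ) (c : V.homotopy n) :
    ∃ z, ∃ hz : z ∈ V.normCycles n, V.cls n z (V.normCycles_le_cycles n hz) = c := by
  obtain ⟨⟨x, hx⟩, rfl⟩ := V.exists_cycle n c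
  obtain ⟨z, hz, u, hu⟩ := V.exists_normCycle n hx
  exact ⟨z, hz, (V.cls_eq_iff n _ _).mpr ⟨u, hu⟩⟩

end

/-! ### The theorem. -/

theorem mainTheorem2 (R : SAlg.{u}) (q i : ℕ) (hi : 2 ≤ i) (hiq : i ≤ q) :
    -- the recursively defined maps are a choice of higher Eilenberg-MacLane maps
    IsHigherEilenbergMacLane EMFam.higherD.{u} ∧
    -- for this choice, Dwyer's construction gives the explicit formula
    (∀ z ∈ R.toVect.normCycles q,
      delta R q i z = R.mulMap (q + i)
        ((EMFam.higherD (q - i) q q (q + i) (by omega)).app R.toVect R.toVect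
          (z ⊗ₜ[ZMod 2] z)) ∧
      delta R q i z = dwyerTheta EMFam.higherD R q i hiq z) ∧
    -- the formula maps normalized cycles to normalized cycles
    ∃ hZ : ∀ z ∈ R.toVect.normCycles q, delta R q i z ∈ R.toVect.normCycles (q + i),
      -- it induces exactly one map on homotopy, the Bousfield-Dwyer operation
      ∃ f : R.toVect.homotopy q → R.toVect.homotopy (q + i),
        (∀ (z : R.toVect.deg q) (hz : z ∈ R.toVect.normCycles q),
          f (R.toVect.cls q z (R.toVect.normCycles_le_cycles q hz)) =
            R.toVect.cls (q + i) (delta R q i z)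
              (R.toVect.normCycles_le_cycles (q + i) (hZ z hz))) ∧
        (∀ g : R.toVect.homotopy q → R.toVect.homotopy (q + i),
          (∀ (z : R.toVect.deg q) (hz : z ∈ R.toVect.normCycles q),
            g (R.toVect.cls q z (R.toVect.normCycles_le_cycles q hz)) =
              R.toVect.cls (q + i) (delta R q i z)
                (R.toVect.normCycles_le_cycles (q + i) (hZ z hz))) →
          g = f) ∧
        IsBousfieldDwyer R q i hiq f := by
  have hD := EMFam.isHigherEilenbergMacLane_higherD.{u}
  have hΘ : ∀ z ∈ R.toVect.normCycles q,
      delta R q i z = dwyerTheta EMFam.higherD R q i hiq z := fun z hz => by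
    rw [dwyerTheta_eq_emProd _ R q i hiq (R.toVect.normCycles_le_cycles q hz)]
    exact delta_eq_higherD R (by omega) hiq _ hz
  refine ⟨hD, fun z hz => ⟨delta_eq_higherD R (by omega) hiq _ hz, hΘ z hz⟩,
    fun z hz => delta_mem_normCycles R hi hiq hz, ?_⟩
  -- The operation is defined by arbitrary cycle representatives and the recursive choice;
  -- invariance under homology and under the choice then gives both descriptions. Uniqueness holds
  -- because normalized cycles meet every class.
  choose rep hrep using R.toVect.exists_cycle q
  let f (c : R.toVect.homotopy q) : R.toVect.homotopy (q + i) :=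
    R.toVect.cls (q + i) _ (dwyerTheta_mem_cycles hD hi hiq (rep c).2)
  have hf : ∀ (x : R.toVect.deg q) (hx : x ∈ R.toVect.cycles q), f (R.toVect.cls q x hx) =
      R.toVect.cls (q + i) _ (dwyerTheta_mem_cycles hD hi hiq hx) := fun x hx =>
    cls_dwyerTheta_congr hD hi hiq _ hx (hrep _)
  have hfδ : ∀ (z : R.toVect.deg q) (hz : z ∈ R.toVect.normCycles q),
      f (R.toVect.cls q z (R.toVect.normCycles_le_cycles q hz)) = R.toVect.cls (q + i)
        (delta R q i z) (R.toVect.normCycles_le_cycles (q + i)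
          (delta_mem_normCycles R hi hiq hz)) := fun z hz => by
    rw [hf]
    congr 1
    exact (hΘ z hz).symm
  refine ⟨f, hfδ, fun g hg => ?_, fun D' hD' x hx => ⟨dwyerTheta_mem_cycles hD' hi hiq hx, ?_⟩⟩
  · funext c
    obtain ⟨z, hz, rfl⟩ := R.toVect.exists_normCycle_cls q c
    rw [hg z hz, hfδ z hz]
  · rw [hf]
    exact cls_dwyerTheta_choice hD hD' hi hiq hx
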